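/- Let $H$ be an $n\times n$ Hermitian matrix, $V$ an $n\times b$ matrix and $k\ge 1$, and suppose the block-Krylov space spanned by the columns of $V, HV,\dots,H^kV$ has dimension $(k+1)b$. Let $Q_1,\dots,Q_{k+1}$ ($n\times b$) and $A_1,\dots,A_k$, $B_0,\dots,B_k$ ($b\times b$) be the output of the block-Lanczos algorithm in exact arithmetic: $V=Q_1B_0$ is a QR factorization and, for $j=1,\dots,k$, with $Z_j=HQ_j-Q_{j-1}B_{j-1}^*$ ($Z_1=HQ_1$), one has $A_j=Q_j^*Z_j$ and $Z_j-Q_jA_j=Q_{j+1}B_j$ is a QR factorization. Here a QR factorization is a factorization into a matrix with orthonormal columns and an upper triangular matrix. Put $Q=[Q_1,\dots,Q_k]$, let $T$ be the $kb\times kb$ block-tridiagonal matrix with diagonal blocks $A_1,\dots,A_k$, subdiagonal blocks $B_1,\dots,B_{k-1}$ and superdiagonal blocks $B_1^*,\dots,B_{k-1}^*$, and let $E_i$ be the $kb\times b$ matrix whose $i$-th $b\times b$ block is the identity and whose other blocks are zero. Define $$\mathsf{lan}_k(f)=Q f(T)E_1B_0,\qquad C(u)=-E_k^*(T-uI)^{-1}E_1B_0,\qquad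 \mathsf{res}_k(u)=V-(H-uI)Q(T-uI)^{-1}E_1B_0 .$$ Assume that $T$ and $B_0$ have real entries, and let $w\in\mathbb C$ be such that $w$ is not an eigenvalue of $T$, $C(w)$ is invertible, and either $w$ is real or $B_k$ has real entries. (All these reality assumptions hold when $H$ and $V$ are real and the algorithm is run in real arithmetic.) Let $S\subset\mathbb R$ be any set containing the spectrum $\Lambda(H)$, and let $\widetilde Q_S(z)=\sup_{x\in S}1/|x-z|\in[0,\infty]$. Let $\Gamma$ be a finite union of positively oriented rectifiable simple closed curves such that each point of $\Lambda(H)\cup\Lambda(T)$ lies in the interior of exactly one of the curves and in the exterior of all the others. Let $f:\mathbb C\to\mathbb C$ be analytic on the interior of each curve and continuous on each curve together with its interior. Then, with $\|\cdot\|_2$ the operator norm, $$\|V^*f(H)V-V^*\mathsf{lan}_k(f)\|_2\le\left(\frac1{2\pi}\oint_\Gamma|f(z)|\,\widetilde Q_S(z)\,\|C(w)^{-1}C(z)\|_2^2\,|dz|\right)\|\mathsf{res}_k(w)\|_2^2 ,$$ where the right-hand side may be $+\infty$ (with the convention $0\cdot\infty=0$ in the integrand). -/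

import Mathlib

open scoped Matrix ENNReal
-- `‖M‖` for a matrix `M` is the operator norm between Euclidean spaces (the two-norm).
open scoped Matrix.Norms.L2Operator

noncomputable section

/-! ### Contours -/

/-- A rectifiable simple closed curve in the complex plane, given by a Lipschitz parametrization
on `[0, 1]` (every rectifiable curve has one, for instance by constant speed). -/
structure SimpleClosedCurve where
  /-- the parametrization; only its values on `[0, 1]` matter -/
  toFun : ℝ → ℂ
  lipschitz : ∃ K : NNReal, LipschitzOnWith K toFun (Set.Icc 0 1)
  closed : toFun 0 = toFun 1
  simple : Set.InjOn toFun (Set.Ico 0 1)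

namespace SimpleClosedCurve

/-- The set of points of the curve. -/
def trace (γ : SimpleClosedCurve) : Set ℂ := γ.toFun '' Set.Icc 0 1

/-- The interior of the curve: the points off the curve whose connected component in the
complement of the curve is bounded. -/
def inside (γ : SimpleClosedCurve) : Set ℂ :=
  {z | z ∉ γ.trace ∧ Bornology.IsBounded (connectedComponentIn γ.traceᶜ z)}

/-- The exterior of the curve. -/
def outside (γ : SimpleClosedCurve) : Set ℂ :=
  {z | z ∉ γ.trace ∧ ¬ Bornology.IsBounded (connectedComponentIn γ.traceᶜ z)}

/-- The winding number `(1 / 2πi) ∮ dζ / (ζ - z)`. -/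
def windingNumber (γ : SimpleClosedCurve) (z : ℂ) : ℂ :=
  (2 * Real.pi * Complex.I)⁻¹ * ∫ t in (0 : ℝ)..1, deriv γ.toFun t / (γ.toFun t - z)

/-- The curve runs counterclockwise: it winds once, in the positive sense, around each point of
its interior. -/
def PositivelyOriented (γ : SimpleClosedCurve) : Prop :=
  ∀ z ∈ γ.inside, γ.windingNumber z = 1

/-- The integral `∮ g(z) |dz|` of a nonnegative function with respect to arc length. -/
def arcIntegral (γ : SimpleClosedCurve) (g : ℂ → ℝ≥0∞) : ℝ≥0∞ :=
  ∫⁻ t in Set.Icc (0 : ℝ) 1, g (γ.toFun t) * ENNReal.ofReal ‖deriv γ.toFun t‖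

end SimpleClosedCurve

/-! ### The block-Lanczos method -/

/-- `Z = Q R` is a (thin) QR factorization: `Q` has orthonormal columns and `R` is upper
triangular. -/
def IsQR {n b : ℕ} (Z Q : Matrix (Fin n) (Fin b) ℂ) (R : Matrix (Fin b) (Fin b) ℂ) : Prop :=
  Qᴴ * Q = 1 ∧ (∀ i j, j < i → R i j = 0) ∧ Z = Q * R

/-- The matrix `Z` of step `j` of block-Lanczos, before orthogonalization against `Q_j`:
`H Q_j - Q_{j-1} B_{j-1}*`, where the second term is absent for `j = 1`. -/
def lanczosZ {n b : ℕ} (H : Matrix (Fin n) (Fin n) ℂ) (Q : ℕ → Matrix (Fin n) (Fin b) ℂ)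
    (B : ℕ → Matrix (Fin b) (Fin b) ℂ) (j : ℕ) : Matrix (Fin n) (Fin b) ℂ :=
  if j = 1 then H * Q 1 else H * Q j - Q (j - 1) * (B (j - 1))ᴴ

/-- `Q_1, …, Q_{k+1}`, `A_1, …, A_k`, `B_0, …, B_k` are the output of `k` iterations of the
block-Lanczos algorithm (in exact arithmetic) applied to `H` and `V`. -/
structure IsBlockLanczos {n b : ℕ} (H : Matrix (Fin n) (Fin n) ℂ) (V : Matrix (Fin n) (Fin b) ℂ)
    (k : ℕ) (Q : ℕ → Matrix (Fin n) (Fin b) ℂ) (A B : ℕ → Matrix (Fin b) (Fin b) ℂ) : Prop where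
  start : IsQR V (Q 1) (B 0)
  diag : ∀ j, 1 ≤ j → j ≤ k → A j = (Q j)ᴴ * lanczosZ H Q B j
  next : ∀ j, 1 ≤ j → j ≤ k → IsQR (lanczosZ H Q B j - Q j * A j) (Q (j + 1)) (B j)

/-- The block-Krylov space spanned by the columns of `V, H V, …, H ^ j V`. -/
def blockKrylov {n b : ℕ} (H : Matrix (Fin n) (Fin n) ℂ) (V : Matrix (Fin n) (Fin b) ℂ) (j : ℕ) :
    Submodule ℂ (Fin n → ℂ) :=
  Submodule.span ℂ {v | ∃ i ≤ j, ∃ q : Fin b, v = (H ^ i * V).col q}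

/-- The `n × kb` matrix `[Q_1, …, Q_k]`. -/
def blockQ {n b : ℕ} (k : ℕ) (Q : ℕ → Matrix (Fin n) (Fin b) ℂ) :
    Matrix (Fin n) (Fin k × Fin b) ℂ :=
  Matrix.of fun i p => Q (p.1 + 1) i p.2

/-- The `kb × kb` block-tridiagonal matrix `T` with diagonal blocks `A_1, …, A_k`, subdiagonal
blocks `B_1, …, B_{k-1}` and superdiagonal blocks `B_1*, …, B_{k-1}*`. -/
def blockT {b : ℕ} (k : ℕ) (A B : ℕ → Matrix (Fin b) (Fin b) ℂ) :
    Matrix (Fin k × Fin b) (Fin k × Fin b) ℂ :=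
  Matrix.of fun p q =>
    if p.1 = q.1 then A (p.1 + 1) p.2 q.2
    else if (p.1 : ℕ) = q.1 + 1 then B (q.1 + 1) p.2 q.2
    else if (q.1 : ℕ) = p.1 + 1 then (B (p.1 + 1))ᴴ p.2 q.2
    else 0

/-- The `kb × b` matrix `E_i` (with `1 ≤ i ≤ k`) whose `i`-th `b × b` block is the identity, all
other blocks being zero. -/
def blockE (k b i : ℕ) : Matrix (Fin k × Fin b) (Fin b) ℂ :=
  Matrix.of fun p q => if (p.1 : ℕ) + 1 = i ∧ p.2 = q then 1 else 0

/-- The block-Lanczos-FA approximation `lan_k(f) = Q f(T) E_1 B_0` to `f(H) V`. Here `f(T)` is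
the continuous functional calculus, that is `U f(D) U*` for `T = U D U*` with `U` unitary and `D`
diagonal. -/
def lanFA {n b : ℕ} (k : ℕ) (Q : ℕ → Matrix (Fin n) (Fin b) ℂ)
    (A B : ℕ → Matrix (Fin b) (Fin b) ℂ) (f : ℂ → ℂ) : Matrix (Fin n) (Fin b) ℂ :=
  blockQ k Q * cfc f (blockT k A B) * blockE k b 1 * B 0

/-- `C(u) = - E_k* (T - u I)⁻¹ E_1 B_0`. -/
def lanC {b : ℕ} (k : ℕ) (A B : ℕ → Matrix (Fin b) (Fin b) ℂ) (u : ℂ) :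
    Matrix (Fin b) (Fin b) ℂ :=
  -((blockE k b k)ᴴ * (blockT k A B - u • 1)⁻¹ * blockE k b 1 * B 0)

/-- The residual `res_k(u) = V - (H - u I) Q (T - u I)⁻¹ E_1 B_0`. -/
def lanRes {n b : ℕ} (H : Matrix (Fin n) (Fin n) ℂ) (V : Matrix (Fin n) (Fin b) ℂ) (k : ℕ)
    (Q : ℕ → Matrix (Fin n) (Fin b) ℂ) (A B : ℕ → Matrix (Fin b) (Fin b) ℂ) (u : ℂ) :
    Matrix (Fin n) (Fin b) ℂ :=
  V - (H - u • 1) * blockQ k Q * (blockT k A B - u • 1)⁻¹ * blockE k b 1 * B 0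

/-- `sup_{x ∈ S} 1 / |x - z|`, with value `∞` when the supremum is infinite. -/
def QTilde (S : Set ℝ) (z : ℂ) : ℝ≥0∞ :=
  ⨆ x ∈ S, (ENNReal.ofReal ‖(x : ℂ) - z‖)⁻¹

/-- All entries of the matrix are real. -/
def HasRealEntries {m n : Type*} (M : Matrix m n ℂ) : Prop :=
  ∀ i j, (M i j).im = 0

end

noncomputable section

/-! ### The Cauchy kernel in the plane -/

section CauchyKernel
open MeasureTheory Metric

/-! The error is linear in `f`. Expanding `f(H)` and `f(T)` over the finite set `σ` of all
eigenvalues writes it as `∑ f(μ) W_μ`, with matrices `W_μ` independent of `f`. Cauchy's formula for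
each `f(μ)` turns this sum into a contour integral of `f(z)` times the error for the function `x ↦
(x - z)⁻¹`, which is explicit: `V*(H-z)⁻¹V - V*Q(T-z)⁻¹E₁B₀ = res(z̄)* (H-z)⁻¹ res(z)`
(`resolvent_identity`). This is Galerkin orthogonality: `res(z) = Q_{k+1} B_k C(z)` is orthogonal to
the range of `Q`. The same factorization gives `res(z) = res(w) C(w)⁻¹ C(z)`, and the reality
assumptions give the same norm bound for `res(z̄)`. With `‖(H-z)⁻¹‖ ≤ Q̃_S(z)` the integrand is
bounded as claimed.

The dimension hypothesis enters through `isUnit_B`: it makes every `B_j` invertible, from which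
follow orthogonality of the blocks and hermiticity of `T`.

The analytic part is Cauchy's theorem for a function that is merely continuous up to a rectifiable
curve. Extend the function to a continuous `G` of compact support. Integrals of `G` over discs of
radius `δ` are Cauchy transforms of its integrals over circles of radius `δ`, so by Fubini and the
winding number, `∮_γ (∫_{B(ζ,δ)} G) dζ` is the area integral over the interior of `z ↦ ∮_{C(z,δ)}
G`. That circle integral vanishes unless `z` is within `δ` of the curve, a set of area `O(δ)`, and
there it is at most `2πδε` for a modulus of continuity `ε`. Dividing `O(δ²ε)` by the disc area `πδ²`
gives `∮_γ G = O(ε)`. -/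

theorem lintegral_ball_enorm_inv_lt_top (r : ℝ) : ∫⁻ z in ball (0 : ℂ) r, ‖z⁻¹‖ₑ < ∞ := by
  have h : IntegrableOn (fun z : ℂ => z⁻¹) (ball 0 r) := by
    refine integrableOn_ball_of_norm_le_rpow (C := 1) (α := 1) (by simp) (by simp) ?_ ?_
    · exact Filter.Eventually.of_forall fun x => by rw [Real.rpow_neg_one]; simp
    · exact measurable_inv.aestronglyMeasurable
  exact h.hasFiniteIntegral

/-- The kernel is at most `1` outside the unit disc about `ζ`, and its integral over that disc does
not depend on `ζ`. Uniformity in `ζ` is what allows a moving pole in Fubini's theorem. -/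
theorem exists_lintegral_enorm_inv_sub_le (R : ℝ) :
    ∃ C : ℝ≥0∞, C < ∞ ∧ ∀ ζ : ℂ, ∫⁻ z in closedBall (0 : ℂ) R, ‖(ζ - z)⁻¹‖ₑ ≤ C := by
  refine ⟨(∫⁻ z in ball (0 : ℂ) 1, ‖z⁻¹‖ₑ) + volume (closedBall (0 : ℂ) R),
    ENNReal.add_lt_top.2 ⟨lintegral_ball_enorm_inv_lt_top 1, measure_closedBall_lt_top⟩, fun ζ => ?_⟩
  calc ∫⁻ z in closedBall (0 : ℂ) R, ‖(ζ - z)⁻¹‖ₑ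
      ≤ ∫⁻ z in closedBall (0 : ℂ) R,
          ((ball (0 : ℂ) 1).indicator (fun z => ‖z⁻¹‖ₑ) (ζ - z) + 1) := by
        refine lintegral_mono fun z => ?_
        by_cases hz : ζ - z ∈ ball (0 : ℂ) 1
        · simp [Set.indicator_of_mem hz]
        · have h1 : 1 ≤ ‖ζ - z‖ := by simpa using hz
          refine le_add_left ?_
          rw [← ofReal_norm, norm_inv, ENNReal.ofReal_le_one]
          exact inv_le_one_of_one_le₀ h1
    _ = (∫⁻ z in closedBall (0 : ℂ) R, (ball (0 : ℂ) 1).indicator (fun z => ‖z⁻¹‖ₑ) (ζ - z))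
          + volume (closedBall (0 : ℂ) R) := by
        rw [lintegral_add_right _ measurable_const]; simp
    _ ≤ (∫⁻ z, (ball (0 : ℂ) 1).indicator (fun z => ‖z⁻¹‖ₑ) (ζ - z))
          + volume (closedBall (0 : ℂ) R) := by
        gcongr; exact Measure.restrict_le_self
    _ = _ := by
        rw [lintegral_sub_left_eq_self (fun z => (ball (0 : ℂ) 1).indicator (fun z => ‖z⁻¹‖ₑ) z) ζ,
          lintegral_indicator measurableSet_ball]

theorem integrable_mul_inv_sub {X : Type*} [MeasurableSpace X] {μ : Measure X} [IsFiniteMeasure μ]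
    {g : X × ℂ → ℂ} {p : X → ℂ} (hg : Measurable g) (hp : Measurable p) {M R : ℝ}
    (hM : ∀ q, ‖g q‖ ≤ M) (hR : ∀ q : X × ℂ, R < ‖q.2‖ → g q = 0) :
    Integrable (fun q : X × ℂ => g q * (p q.1 - q.2)⁻¹) (μ.prod volume) := by
  have hmeas : Measurable (fun q : X × ℂ => g q * (p q.1 - q.2)⁻¹) := by fun_prop
  refine ⟨hmeas.aestronglyMeasurable, ?_⟩
  obtain ⟨C, hC, hC'⟩ := exists_lintegral_enorm_inv_sub_le R
  rw [HasFiniteIntegral, lintegral_prod _ hmeas.enorm.aemeasurable]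
  calc ∫⁻ x, ∫⁻ z, ‖g (x, z) * (p x - z)⁻¹‖ₑ ∂volume ∂μ
      ≤ ∫⁻ _, ENNReal.ofReal M * C ∂μ := by
        refine lintegral_mono fun x => ?_
        calc ∫⁻ z, ‖g (x, z) * (p x - z)⁻¹‖ₑ
            ≤ ∫⁻ z, (closedBall (0 : ℂ) R).indicator
                (fun z => ENNReal.ofReal M * ‖(p x - z)⁻¹‖ₑ) z := by
              refine lintegral_mono fun z => ?_
              by_cases hz : z ∈ closedBall (0 : ℂ) R
              · rw [Set.indicator_of_mem hz, enorm_mul]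
                gcongr
                rw [← ofReal_norm]
                exact ENNReal.ofReal_le_ofReal (hM _)
              · rw [hR (x, z) (by simpa using hz)]; simp
          _ = ENNReal.ofReal M * ∫⁻ z in closedBall (0 : ℂ) R, ‖(p x - z)⁻¹‖ₑ := by
              rw [lintegral_indicator measurableSet_closedBall, lintegral_const_mul]
              fun_prop
          _ ≤ _ := by gcongr; exact hC' _
    _ < ∞ := by
        rw [lintegral_const]
        exact ENNReal.mul_lt_top (ENNReal.mul_lt_top ENNReal.ofReal_lt_top hC) (measure_lt_top _ _)

theorem circleIntegral_inv_sub_eq_indicator {ζ v : ℂ} {δ : ℝ} (hδ : 0 ≤ δ)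
    (hv : v ∉ sphere ζ δ) :
    (∮ s in C(ζ, δ), (s - v)⁻¹) = (ball ζ δ).indicator (fun _ => 2 * Real.pi * Complex.I) v := by
  by_cases h : v ∈ ball ζ δ
  · rw [Set.indicator_of_mem h, circleIntegral.integral_sub_inv_of_mem_ball h]
  · rw [Set.indicator_of_notMem h]
    have hne : ∀ s ∈ closedBall ζ δ, s - v ≠ 0 := by
      rintro s hs h0
      rw [sub_eq_zero] at h0
      subst h0
      rw [← ball_union_sphere] at hs
      exact hs.elim h hv
    refine Complex.circleIntegral_eq_zero_of_differentiable_on_off_countable hδ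
      Set.countable_empty ?_ ?_
    · exact ContinuousOn.inv₀ (by fun_prop) hne
    · intro s hs
      have := hne s (ball_subset_closedBall hs.1)
      fun_prop (disch := assumption)

/-- The Cauchy transform of the circle integrals of `G` is a multiple of the disc averages of `G`. -/
theorem integral_circleIntegral_mul_inv_sub {G : ℂ → ℂ} (hG : Continuous G)
    (hGc : HasCompactSupport G) {δ : ℝ} (hδ : 0 ≤ δ) (ζ : ℂ) :
    ∫ z, (∮ s in C(z, δ), G s) * (ζ - z)⁻¹ =
      2 * Real.pi * Complex.I * ∫ v in ball ζ δ, G v := by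
  obtain ⟨M, hM⟩ := hG.bounded_above_of_compact_support hGc
  obtain ⟨R, hR⟩ := hGc.isCompact.isBounded.subset_closedBall 0
  have hGR : ∀ v, R < ‖v‖ → G v = 0 := fun v hv => by
    by_contra h
    have := hR (subset_tsupport G h)
    simp at this; linarith
  let μ : Measure ℝ := volume.restrict (Set.Ioc 0 (2 * Real.pi))
  let a : ℝ → ℂ := fun θ => circleMap 0 δ θ * Complex.I
  have ha : Continuous a := by fun_prop
  have haδ : ∀ θ, ‖a θ‖ = δ := fun θ => by simp [a, abs_of_nonneg hδ]
  have hcirc : ∀ (F : ℂ → ℂ) (c : ℂ), (∮ s in C(c, δ), F s) =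
      ∫ θ, a θ * F (c + circleMap 0 δ θ) ∂μ := fun F c => by
    rw [circleIntegral, intervalIntegral.integral_of_le (by positivity)]
    refine integral_congr_ae (Filter.Eventually.of_forall fun θ => ?_)
    simp [a, circleMap]
  have hI1 : Integrable (fun q : ℝ × ℂ =>
      (a q.1 * G (q.2 + circleMap 0 δ q.1)) * (ζ - q.2)⁻¹) (μ.prod volume) := by
    refine integrable_mul_inv_sub (g := fun q : ℝ × ℂ => a q.1 * G (q.2 + circleMap 0 δ q.1))
      (p := fun _ => ζ) (M := δ * M) (R := R + δ) ?_ measurable_const ?_ ?_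
    · exact Continuous.measurable (by fun_prop)
    · intro q
      rw [norm_mul, haδ]
      exact mul_le_mul_of_nonneg_left (hM _) hδ
    · intro q hq
      rw [hGR, mul_zero]
      have : ‖q.2‖ ≤ ‖q.2 + circleMap 0 δ q.1‖ + ‖circleMap 0 δ q.1‖ := by
        simpa using norm_sub_le (q.2 + circleMap 0 δ q.1) (circleMap 0 δ q.1)
      have h2 : ‖circleMap 0 δ q.1‖ = δ := by simp [abs_of_nonneg hδ]
      linarith
  have hI2 : Integrable (fun q : ℝ × ℂ =>
      (a q.1 * G q.2) * ((ζ + circleMap 0 δ q.1) - q.2)⁻¹) (μ.prod volume) := by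
    refine integrable_mul_inv_sub (g := fun q : ℝ × ℂ => a q.1 * G q.2)
      (p := fun θ => ζ + circleMap 0 δ θ) (M := δ * M) (R := R) ?_ ?_ ?_ ?_
    · exact Continuous.measurable (by fun_prop)
    · exact Continuous.measurable (by fun_prop)
    · intro q
      rw [norm_mul, haδ]
      exact mul_le_mul_of_nonneg_left (hM _) hδ
    · intro q hq
      rw [hGR _ hq, mul_zero]
  calc ∫ z, (∮ s in C(z, δ), G s) * (ζ - z)⁻¹
      = ∫ z, ∫ θ, (a θ * G (z + circleMap 0 δ θ)) * (ζ - z)⁻¹ ∂μ := by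
        refine integral_congr_ae (Filter.Eventually.of_forall fun z => ?_)
        dsimp only
        rw [hcirc, integral_mul_const]
    _ = ∫ θ, (∫ z, (a θ * G (z + circleMap 0 δ θ)) * (ζ - z)⁻¹) ∂μ :=
        (integral_integral_swap hI1).symm
    -- Translating by the point of the circle moves the shift from `G` to the pole; the integral
    -- over `θ` then becomes the winding integral of the circle about `v`.
    _ = ∫ θ, (∫ v, (a θ * G v) * ((ζ + circleMap 0 δ θ) - v)⁻¹) ∂μ := by
        refine integral_congr_ae (Filter.Eventually.of_forall fun θ => ?_)
        dsimp only
        rw [← integral_add_right_eq_self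
          (fun v => (a θ * G v) * ((ζ + circleMap 0 δ θ) - v)⁻¹) (circleMap 0 δ θ)]
        simp only [add_sub_add_right_eq_sub]
    _ = ∫ v, (∫ θ, (a θ * G v) * ((ζ + circleMap 0 δ θ) - v)⁻¹ ∂μ) :=
        integral_integral_swap hI2
    _ = ∫ v, G v * ∮ s in C(ζ, δ), (s - v)⁻¹ := by
        refine integral_congr_ae (Filter.Eventually.of_forall fun v => ?_)
        dsimp only
        rw [hcirc (fun s => (s - v)⁻¹), ← integral_const_mul]
        refine integral_congr_ae (Filter.Eventually.of_forall fun θ => ?_)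
        ring
    _ = ∫ v, (ball ζ δ).indicator (fun v => 2 * Real.pi * Complex.I * G v) v := by
        have h0 : ∀ᵐ v, v ∉ sphere ζ δ :=
          measure_eq_zero_iff_ae_notMem.1 (Measure.addHaar_sphere volume ζ δ)
        refine integral_congr_ae ?_
        filter_upwards [h0] with v hv
        rw [circleIntegral_inv_sub_eq_indicator hδ hv]
        by_cases h : v ∈ ball ζ δ <;> simp [h, mul_comm]
    _ = _ := by
        rw [integral_indicator measurableSet_ball, integral_const_mul]

end CauchyKernel

/-! ### Geometry of a rectifiable curve -/

namespace SimpleClosedCurve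
open MeasureTheory Metric Set

variable (γ : SimpleClosedCurve)

theorem continuousOn : ContinuousOn γ.toFun (Icc 0 1) := γ.lipschitz.choose_spec.continuousOn

theorem isCompact_trace : IsCompact γ.trace := isCompact_Icc.image_of_continuousOn γ.continuousOn

theorem isOpen_compl_trace : IsOpen γ.traceᶜ := γ.isCompact_trace.isClosed.isOpen_compl

theorem mem_trace {t : ℝ} (ht : t ∈ Icc (0 : ℝ) 1) : γ.toFun t ∈ γ.trace := mem_image_of_mem _ ht

theorem mem_trace_of_mem_Ioo {t : ℝ} (ht : t ∈ Ioo (0 : ℝ) 1) : γ.toFun t ∈ γ.trace :=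
  γ.mem_trace (Ioo_subset_Icc_self ht)

theorem connectedComponentIn_subset_inside {z : ℂ} (hz : z ∈ γ.inside) :
    connectedComponentIn γ.traceᶜ z ⊆ γ.inside := fun w hw =>
  ⟨connectedComponentIn_subset _ _ hw, by rw [← connectedComponentIn_eq hw]; exact hz.2⟩

theorem isOpen_inside : IsOpen γ.inside := by
  rw [isOpen_iff_mem_nhds]
  intro z hz
  exact Filter.mem_of_superset
    ((γ.isOpen_compl_trace.connectedComponentIn).mem_nhds (mem_connectedComponentIn hz.1))
    (γ.connectedComponentIn_subset_inside hz)

theorem isOpen_outside : IsOpen γ.outside := by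
  rw [isOpen_iff_mem_nhds]
  intro z hz
  refine Filter.mem_of_superset
    ((γ.isOpen_compl_trace.connectedComponentIn).mem_nhds (mem_connectedComponentIn hz.1)) ?_
  exact fun w hw =>
    ⟨connectedComponentIn_subset _ _ hw, by rw [← connectedComponentIn_eq hw]; exact hz.2⟩

theorem compl_outside : γ.outsideᶜ = γ.inside ∪ γ.trace := by
  ext z
  simp only [outside, inside, mem_compl_iff, mem_ofPred_eq, mem_union]
  tauto

theorem isClosed_inside_union_trace : IsClosed (γ.inside ∪ γ.trace) := by
  rw [← compl_outside]
  exact γ.isOpen_outside.isClosed_compl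

theorem subset_inside_of_isPreconnected {s : Set ℂ} (hs : IsPreconnected s) {z : ℂ} (hz : z ∈ s)
    (hzi : z ∈ γ.inside) (hst : Disjoint s γ.trace) : s ⊆ γ.inside :=
  (hs.subset_connectedComponentIn hz hst.subset_compl_right).trans
    (γ.connectedComponentIn_subset_inside hzi)

theorem exists_trace_subset_closedBall : ∃ R, 0 < R ∧ γ.trace ⊆ closedBall 0 R := by
  obtain ⟨R, hR, h⟩ := γ.isCompact_trace.isBounded.exists_pos_norm_le
  exact ⟨R, hR, fun z hz => by simpa using h z hz⟩

/-- An interior point farther from `0` than the whole curve could be pushed radially to infinity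
without meeting the curve, so its component would be unbounded. -/
theorem isBounded_inside : Bornology.IsBounded γ.inside := by
  obtain ⟨R, hR, hRt⟩ := γ.exists_trace_subset_closedBall
  refine (isBounded_closedBall (x := (0 : ℂ)) (r := R)).subset fun z hz => ?_
  by_contra hzR
  have hzR' : R < ‖z‖ := by simpa using hzR
  have hray : IsPreconnected ((fun s : ℝ => (s : ℂ) * z) '' Ici 1) :=
    (convex_Ici (1 : ℝ)).isPreconnected.image _ (by fun_prop)
  have hsub := γ.subset_inside_of_isPreconnected hray (z := z) ⟨1, by simp, by simp⟩ hz (by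
    rw [disjoint_left]
    rintro _ ⟨s, hs, rfl⟩ hst
    have h1 : ‖(s : ℂ) * z‖ ≤ R := by simpa using hRt hst
    have hs1 : (1 : ℝ) ≤ s := hs
    rw [norm_mul, Complex.norm_real, Real.norm_of_nonneg (by linarith)] at h1
    nlinarith [norm_nonneg z])
  have hcomp := hz.2
  obtain ⟨M, hM, hMb⟩ := (hcomp.subset
    (hray.subset_connectedComponentIn (x := z) ⟨1, by simp, by simp⟩
      fun w hw => (hsub hw).1)).exists_pos_norm_le
  have h2 := hMb (((1 + M / R : ℝ) : ℂ) * z) ⟨1 + M / R, by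
    simp only [mem_Ici, le_add_iff_nonneg_right]; positivity, rfl⟩
  rw [norm_mul, Complex.norm_real, Real.norm_of_nonneg (by positivity)] at h2
  have h3 : (1 + M / R) * R < (1 + M / R) * ‖z‖ := by gcongr
  have h4 : (1 + M / R) * R = R + M := by field_simp
  linarith

theorem isCompact_inside_union_trace : IsCompact (γ.inside ∪ γ.trace) :=
  isCompact_of_isClosed_isBounded γ.isClosed_inside_union_trace
    (γ.isBounded_inside.union γ.isCompact_trace.isBounded)

/-- About `1/δ` equally spaced parameters give discs of radius `(K+1)δ` covering the neighbourhood,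
so its area is `O(δ⁻¹ · δ²)`. Rectifiability is essential here. -/
theorem exists_volume_cthickening_le :
    ∃ C : ℝ, 0 ≤ C ∧ ∀ δ, 0 < δ → δ ≤ 1 →
      volume (cthickening δ γ.trace) ≤ ENNReal.ofReal (C * δ) := by
  obtain ⟨K, hK⟩ := γ.lipschitz
  refine ⟨3 * Real.pi * (K + 1) ^ 2, by positivity, fun δ hδ hδ1 => ?_⟩
  set N := ⌈1 / δ⌉₊ with hN
  have hN1 : 1 / δ ≤ N := Nat.le_ceil _
  have hN2 : (N : ℝ) < 1 / δ + 1 := Nat.ceil_lt_add_one (by positivity)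
  have hN0 : (0 : ℝ) < N := lt_of_lt_of_le (by positivity) hN1
  have hNδ : 1 / (N : ℝ) ≤ δ := by
    rw [div_le_iff₀ hN0]; rw [div_le_iff₀ hδ] at hN1; linarith
  have hcover : cthickening δ γ.trace ⊆
      ⋃ j ∈ Finset.range (N + 1), closedBall (γ.toFun (j / N)) ((K + 1) * δ) := by
    rw [γ.isCompact_trace.cthickening_eq_biUnion_closedBall hδ.le]
    simp only [iUnion_subset_iff]
    rintro _ ⟨t, ht, rfl⟩ z hz
    have htN : 0 ≤ t * N := mul_nonneg ht.1 hN0.le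
    have hj1 := Nat.floor_le htN
    have hj2 := Nat.lt_floor_add_one (t * N)
    set j := ⌊t * N⌋₊ with hj
    have hjN : (j : ℝ) ≤ N := hj1.trans (by nlinarith [ht.2])
    simp only [mem_iUnion, Finset.mem_range]
    refine ⟨j, by have : j ≤ N := by exact_mod_cast hjN
                  omega, ?_⟩
    have hjmem : (j : ℝ) / N ∈ Icc (0 : ℝ) 1 := ⟨by positivity, by rw [div_le_one hN0]; exact hjN⟩
    have hd : dist t ((j : ℝ) / N) ≤ δ := by
      refine le_trans ?_ hNδ
      rw [Real.dist_eq, abs_le]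
      constructor
      · rw [← sub_nonneg]; field_simp; linarith
      · rw [← sub_nonneg]; field_simp; linarith
    have := hK.dist_le_mul t ht _ hjmem
    rw [mem_closedBall] at hz ⊢
    calc dist z _ ≤ dist z (γ.toFun t) + dist (γ.toFun t) (γ.toFun (j / N)) := dist_triangle _ _ _
      _ ≤ δ + K * δ := by gcongr; exact this.trans (by gcongr)
      _ = _ := by ring
  calc volume (cthickening δ γ.trace)
      ≤ ∑ j ∈ Finset.range (N + 1), volume (closedBall (γ.toFun (j / N)) ((K + 1) * δ)) :=
        (measure_mono hcover).trans (measure_biUnion_finset_le _ _)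
    _ = ENNReal.ofReal ((N + 1) * (((K + 1) * δ) ^ 2 * Real.pi)) := by
        simp only [Complex.volume_closedBall, Finset.sum_const, Finset.card_range, nsmul_eq_mul]
        rw [ENNReal.ofReal_mul (by positivity : (0 : ℝ) ≤ N + 1),
          ENNReal.ofReal_mul (by positivity : (0 : ℝ) ≤ ((K + 1) * δ) ^ 2), ENNReal.ofReal_pow (by positivity)]
        congr 1
        · rw [← Nat.cast_succ, ENNReal.ofReal_natCast]
        · congr 1
          rw [← NNReal.coe_real_pi, ENNReal.ofReal_coe_nnreal]
    _ ≤ _ := by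
        apply ENNReal.ofReal_le_ofReal
        -- `N + 1 < 1/δ + 2` and `δ ≤ 1`, hence the constant `3`.
        have h3 : (N + 1 : ℝ) * δ ≤ 3 := by
          have : (1 / δ + 1 + 1) * δ = 1 + 2 * δ := by field_simp; ring
          nlinarith
        calc (N + 1) * (((K + 1) * δ) ^ 2 * Real.pi)
            = ((N + 1) * δ) * (Real.pi * (K + 1) ^ 2 * δ) := by ring
          _ ≤ 3 * (Real.pi * (K + 1) ^ 2 * δ) := by gcongr
          _ = _ := by ring

theorem volume_trace : volume γ.trace = 0 := by
  obtain ⟨C, hC, h⟩ := γ.exists_volume_cthickening_le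
  have htend : Filter.Tendsto (fun δ : ℝ => ENNReal.ofReal (C * δ)) (nhdsWithin 0 (Ioi 0))
      (nhds 0) := by
    have : Filter.Tendsto (fun δ : ℝ => ENNReal.ofReal (C * δ)) (nhds 0)
      (nhds (ENNReal.ofReal (C * 0))) := by
      exact (ENNReal.continuous_ofReal.comp (continuous_const_mul C)).tendsto 0
    simp only [mul_zero, ENNReal.ofReal_zero] at this
    exact this.mono_left nhdsWithin_le_nhds
  refine le_antisymm (ge_of_tendsto htend ?_) zero_le
  filter_upwards [Ioc_mem_nhdsGT (zero_lt_one' ℝ)] with δ hδ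
  exact (measure_mono (self_subset_cthickening _)).trans (h δ hδ.1 hδ.2)

/-- The open interval matters: at `0` and `1` the two-sided `deriv` depends on values outside `[0,
1]`, about which nothing is assumed. -/
theorem norm_deriv_le {K : NNReal} (hK : LipschitzOnWith K γ.toFun (Icc 0 1)) {t : ℝ}
    (ht : t ∈ Ioo (0 : ℝ) 1) : ‖deriv γ.toFun t‖ ≤ K :=
  norm_deriv_le_of_lipschitzOn (Icc_mem_nhds ht.1 ht.2) hK

/-! ### Contour integrals -/

/-- The contour integral `∮ g(z) dz`. -/
def contourIntegral (g : ℂ → ℂ) : ℂ :=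
  ∫ t in Ioo (0 : ℝ) 1, deriv γ.toFun t * g (γ.toFun t)

theorem windingNumber_eq (z : ℂ) : γ.windingNumber z =
    (2 * Real.pi * Complex.I)⁻¹ * γ.contourIntegral fun ζ => (ζ - z)⁻¹ := by
  rw [windingNumber, intervalIntegral.integral_of_le zero_le_one, integral_Ioc_eq_integral_Ioo,
    contourIntegral]
  simp only [div_eq_mul_inv]

theorem aestronglyMeasurable_comp {g : ℂ → ℂ} (hg : ContinuousOn g γ.trace) :
    AEStronglyMeasurable (fun t => g (γ.toFun t)) (volume.restrict (Ioo (0 : ℝ) 1)) :=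
  ((hg.comp γ.continuousOn fun _ ht => γ.mem_trace ht).mono
    Ioo_subset_Icc_self).aestronglyMeasurable measurableSet_Ioo

theorem integrable_deriv : IntegrableOn (deriv γ.toFun) (Ioo (0 : ℝ) 1) := by
  obtain ⟨K, hK⟩ := γ.lipschitz
  refine Measure.integrableOn_of_bounded (M := K) (by simp)
    (measurable_deriv _).aestronglyMeasurable ?_
  filter_upwards [ae_restrict_mem measurableSet_Ioo] with t ht using γ.norm_deriv_le hK ht

theorem integrable_deriv_mul {g : ℂ → ℂ} (hg : ContinuousOn g γ.trace) :
    IntegrableOn (fun t => deriv γ.toFun t * g (γ.toFun t)) (Ioo (0 : ℝ) 1) := by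
  obtain ⟨M, hM⟩ := γ.isCompact_trace.exists_bound_of_continuousOn hg
  refine Integrable.mul_bdd (c := M) γ.integrable_deriv (γ.aestronglyMeasurable_comp hg) ?_
  filter_upwards [ae_restrict_mem measurableSet_Ioo] with t ht
    using hM _ (γ.mem_trace_of_mem_Ioo ht)

theorem contourIntegral_congr {g h : ℂ → ℂ} (hgh : EqOn g h γ.trace) :
    γ.contourIntegral g = γ.contourIntegral h := by
  refine setIntegral_congr_fun measurableSet_Ioo fun t ht => ?_
  rw [hgh (γ.mem_trace_of_mem_Ioo ht)]

theorem contourIntegral_sub {g h : ℂ → ℂ} (hg : ContinuousOn g γ.trace)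
    (hh : ContinuousOn h γ.trace) :
    γ.contourIntegral (fun z => g z - h z) = γ.contourIntegral g - γ.contourIntegral h := by
  simp only [contourIntegral, mul_sub]
  exact integral_sub (γ.integrable_deriv_mul hg) (γ.integrable_deriv_mul hh)

theorem contourIntegral_const_mul (c : ℂ) (g : ℂ → ℂ) :
    γ.contourIntegral (fun z => c * g z) = c * γ.contourIntegral g := by
  simp only [contourIntegral, mul_left_comm _ c]
  exact integral_const_mul _ _

theorem norm_contourIntegral_le {K : NNReal} (hK : LipschitzOnWith K γ.toFun (Icc 0 1))
    {g : ℂ → ℂ} {M : ℝ} (hM : ∀ z ∈ γ.trace, ‖g z‖ ≤ M) : ‖γ.contourIntegral g‖ ≤ K * M := by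
  have := norm_setIntegral_le_of_norm_le_const (μ := volume) (s := Ioo (0 : ℝ) 1) (C := K * M)
    (f := fun t => deriv γ.toFun t * g (γ.toFun t)) (by simp) fun t ht => by
      rw [norm_mul]
      gcongr
      · exact γ.norm_deriv_le hK ht
      · exact hM _ (γ.mem_trace_of_mem_Ioo ht)
  simpa [contourIntegral] using this

end SimpleClosedCurve

/-! ### The winding number vanishes in the exterior -/

section
open MeasureTheory Set

/-- The fundamental theorem of calculus for complex-valued Lipschitz functions. -/
theorem LipschitzOnWith.integral_deriv_eq_sub_complex {f : ℝ → ℂ} {K : NNReal} {a b : ℝ}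
    (hab : a ≤ b) (hf : LipschitzOnWith K f (Icc a b)) :
    ∫ t in Ioo a b, deriv f t = f b - f a := by
  have hre : LipschitzOnWith K (fun t => (f t).re) (uIcc a b) := by
    rw [uIcc_of_le hab]
    have := Complex.reCLM.lipschitz.comp_lipschitzOnWith hf
    rw [Complex.reCLM_nnnorm, one_mul] at this
    exact this
  have him : LipschitzOnWith K (fun t => (f t).im) (uIcc a b) := by
    rw [uIcc_of_le hab]
    have := Complex.imCLM.lipschitz.comp_lipschitzOnWith hf
    rw [Complex.imCLM_nnnorm, one_mul] at this
    exact this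
  have h1 := hre.absolutelyContinuousOnInterval.integral_deriv_eq_sub
  have h2 := him.absolutelyContinuousOnInterval.integral_deriv_eq_sub
  rw [intervalIntegral.integral_of_le hab, integral_Ioc_eq_integral_Ioo] at h1 h2
  have hdiff : ∀ᵐ t ∂volume.restrict (Ioo a b), DifferentiableAt ℝ f t := by
    rw [ae_restrict_iff' measurableSet_Ioo]
    filter_upwards [hf.ae_differentiableWithinAt_of_mem_real] with t ht hab
    exact (ht (Ioo_subset_Icc_self hab)).differentiableAt (Icc_mem_nhds hab.1 hab.2)
  have hint : IntegrableOn (deriv f) (Ioo a b) := by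
    refine Measure.integrableOn_of_bounded (M := K) (by simp)
      (measurable_deriv _).aestronglyMeasurable ?_
    filter_upwards [ae_restrict_mem measurableSet_Ioo] with t ht
      using norm_deriv_le_of_lipschitzOn (Icc_mem_nhds ht.1 ht.2) hf
  apply Complex.ext
  · have := Complex.reCLM.integral_comp_comm hint
    simp only [Complex.reCLM_apply] at this
    rw [← this, Complex.sub_re, ← h1]
    refine integral_congr_ae ?_
    filter_upwards [hdiff] with t ht
    exact ((Complex.reCLM.hasFDerivAt.comp_hasDerivAt t ht.hasDerivAt).deriv).symm
  · have := Complex.imCLM.integral_comp_comm hint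
    simp only [Complex.imCLM_apply] at this
    rw [← this, Complex.sub_im, ← h2]
    refine integral_congr_ae ?_
    filter_upwards [hdiff] with t ht
    exact ((Complex.imCLM.hasFDerivAt.comp_hasDerivAt t ht.hasDerivAt).deriv).symm

end

namespace SimpleClosedCurve
open MeasureTheory Metric Set

variable (γ : SimpleClosedCurve)

theorem ae_differentiableAt :
    ∀ᵐ t ∂volume.restrict (Ioo (0 : ℝ) 1), DifferentiableAt ℝ γ.toFun t := by
  obtain ⟨K, hK⟩ := γ.lipschitz
  rw [ae_restrict_iff' measurableSet_Ioo]
  filter_upwards [hK.ae_differentiableWithinAt_of_mem_real] with t ht hab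
  exact (ht (Ioo_subset_Icc_self hab)).differentiableAt (Icc_mem_nhds hab.1 hab.2)

theorem exists_pos_le_norm_sub {z : ℂ} (hz : z ∉ γ.trace) :
    ∃ d, 0 < d ∧ ∀ ζ ∈ γ.trace, d ≤ ‖ζ - z‖ := by
  obtain ⟨d, hd, h⟩ := Metric.isOpen_iff.1 γ.isOpen_compl_trace z hz
  refine ⟨d, hd, fun ζ hζ => ?_⟩
  by_contra hlt
  exact h (by rw [mem_ball, dist_eq_norm]; exact not_le.1 hlt) hζ

/-- Up to sign the integrand has the primitive `(ζ - z)⁻¹`, which is Lipschitz along the curve and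
takes equal values at the two ends. -/
theorem contourIntegral_inv_sub_sq {z : ℂ} (hz : z ∉ γ.trace) :
    γ.contourIntegral (fun ζ => ((ζ - z) ^ 2)⁻¹) = 0 := by
  obtain ⟨K, hK⟩ := γ.lipschitz
  obtain ⟨d, hd, hdz⟩ := γ.exists_pos_le_norm_sub hz
  have hlip : LipschitzOnWith (K * (Real.toNNReal (d⁻¹ * d⁻¹)))
      (fun t => (γ.toFun t - z)⁻¹) (Icc 0 1) := by
    refine LipschitzOnWith.of_dist_le_mul fun s hs t ht => ?_
    have h1 := hdz _ (γ.mem_trace hs)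
    have h2 := hdz _ (γ.mem_trace ht)
    have hne1 : γ.toFun s - z ≠ 0 := norm_pos_iff.1 (hd.trans_le h1)
    have hne2 : γ.toFun t - z ≠ 0 := norm_pos_iff.1 (hd.trans_le h2)
    have h3 := hK.dist_le_mul s hs t ht
    rw [dist_eq_norm, inv_sub_inv hne1 hne2, norm_div, norm_mul, NNReal.coe_mul,
      Real.coe_toNNReal _ (by positivity), sub_sub_sub_cancel_right, div_eq_mul_inv, mul_inv,
      mul_right_comm]
    rw [dist_comm, dist_eq_norm] at h3
    gcongr
  have h := LipschitzOnWith.integral_deriv_eq_sub_complex zero_le_one hlip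
  simp only [γ.closed, sub_self] at h
  rw [contourIntegral, ← neg_eq_zero, ← integral_neg, ← h]
  refine integral_congr_ae ?_
  filter_upwards [γ.ae_differentiableAt, ae_restrict_mem measurableSet_Ioo] with t ht ht'
  have hne : γ.toFun t - z ≠ 0 :=
    norm_pos_iff.1 (hd.trans_le (hdz _ (γ.mem_trace_of_mem_Ioo ht')))
  have hinv : HasDerivAt (fun t => (γ.toFun t - z)⁻¹) _ t := (ht.hasDerivAt.sub_const z).inv hne
  rw [hinv.deriv, div_eq_mul_inv, neg_mul]

/-- Differentiation under the integral sign gives the integral of `(ζ - z)⁻²`, which is zero; so the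
winding number is locally constant off the curve. -/
theorem hasDerivAt_contourIntegral_inv_sub {z : ℂ} (hz : z ∉ γ.trace) :
    HasDerivAt (fun z => γ.contourIntegral fun ζ => (ζ - z)⁻¹) 0 z := by
  obtain ⟨K, hK⟩ := γ.lipschitz
  obtain ⟨d, hd, hdz⟩ := γ.exists_pos_le_norm_sub hz
  have hball : ∀ w ∈ ball z (d / 2), ∀ ζ ∈ γ.trace, d / 2 ≤ ‖ζ - w‖ := fun w hw ζ hζ => by
    have h1 := hdz ζ hζ
    have h2 : ‖w - z‖ < d / 2 := by simpa [dist_eq_norm] using hw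
    have h3 : ‖ζ - z‖ ≤ ‖ζ - w‖ + ‖w - z‖ := by simpa using norm_add_le (ζ - w) (w - z)
    linarith
  have hcont : ∀ w ∈ ball z (d / 2), ContinuousOn (fun ζ => (ζ - w)⁻¹) γ.trace := fun w hw =>
    ContinuousOn.inv₀ (by fun_prop) fun ζ hζ =>
      norm_pos_iff.1 ((half_pos hd).trans_le (hball w hw ζ hζ))
  have hzb : z ∈ ball z (d / 2) := mem_ball_self (half_pos hd)
  have h := (hasDerivAt_integral_of_dominated_loc_of_deriv_le
    (μ := volume.restrict (Ioo (0 : ℝ) 1)) (𝕜 := ℂ) (x₀ := z) (s := ball z (d / 2))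
    (F := fun w t => deriv γ.toFun t * (γ.toFun t - w)⁻¹)
    (F' := fun w t => deriv γ.toFun t * ((γ.toFun t - w) ^ 2)⁻¹)
    (bound := fun _ => K * ((d / 2) ^ 2)⁻¹)
    (ball_mem_nhds z (half_pos hd)) ?_ ?_ ?_ ?_ (integrable_const _) ?_).2
  · have h0 := γ.contourIntegral_inv_sub_sq hz
    rw [contourIntegral] at h0
    rw [h0] at h
    exact h
  · filter_upwards [ball_mem_nhds z (half_pos hd)] with w hw
      using (γ.integrable_deriv_mul (hcont w hw)).aestronglyMeasurable
  · exact γ.integrable_deriv_mul (hcont z hzb)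
  · refine (γ.integrable_deriv_mul (g := fun ζ => ((ζ - z) ^ 2)⁻¹) ?_).aestronglyMeasurable
    simp only [← inv_pow]
    exact (hcont z hzb).pow 2
  · filter_upwards [ae_restrict_mem measurableSet_Ioo] with t ht w hw
    have := hball w hw _ (γ.mem_trace_of_mem_Ioo ht)
    rw [norm_mul, norm_inv, norm_pow]
    gcongr
    exact γ.norm_deriv_le hK ht
  · filter_upwards [ae_restrict_mem measurableSet_Ioo] with t ht w hw
    have hne : γ.toFun t - w ≠ 0 :=
      norm_pos_iff.1 ((half_pos hd).trans_le (hball w hw _ (γ.mem_trace_of_mem_Ioo ht)))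
    have := (((hasDerivAt_id w).const_sub (γ.toFun t)).inv hne).const_mul (deriv γ.toFun t)
    simpa using this

/-- The integral is constant on an unbounded component and tends to zero at infinity. -/
theorem contourIntegral_inv_sub_of_outside {z : ℂ} (hz : z ∈ γ.outside) :
    γ.contourIntegral (fun ζ => (ζ - z)⁻¹) = 0 := by
  obtain ⟨K, hK⟩ := γ.lipschitz
  obtain ⟨R, hR, hRt⟩ := γ.exists_trace_subset_closedBall
  set U := connectedComponentIn γ.traceᶜ z with hU
  have hzU : z ∈ U := mem_connectedComponentIn hz.1
  have hconst : ∀ w ∈ U, γ.contourIntegral (fun ζ => (ζ - w)⁻¹) =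
      γ.contourIntegral (fun ζ => (ζ - z)⁻¹) := fun w hw => by
    refine (γ.isOpen_compl_trace.connectedComponentIn).is_const_of_deriv_eq_zero
      isPreconnected_connectedComponentIn
      (f := fun w => γ.contourIntegral fun ζ => (ζ - w)⁻¹) ?_ ?_ hw hzU
    · exact fun v hv => (γ.hasDerivAt_contourIntegral_inv_sub
        (connectedComponentIn_subset _ _ hv)).differentiableAt.differentiableWithinAt
    · exact fun v hv => (γ.hasDerivAt_contourIntegral_inv_sub
        (connectedComponentIn_subset _ _ hv)).deriv
  by_contra hne
  set I := γ.contourIntegral (fun ζ => (ζ - z)⁻¹) with hI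
  have hI0 : 0 < ‖I‖ := norm_pos_iff.2 hne
  -- At such a `w` the distance to the curve exceeds `(K+1)/‖I‖`, so the trivial bound yields `‖I‖ ≤
  -- K‖I‖/(K+1)`, impossible for `I ≠ 0`.
  have hex : ∃ w ∈ U, R + (K + 1) / ‖I‖ < ‖w‖ := by
    by_contra hall
    push Not at hall
    exact hz.2 ((isBounded_closedBall (x := (0 : ℂ)) (r := R + (K + 1) / ‖I‖)).subset
      fun w hw => by simpa using hall w hw)
  obtain ⟨w, hw, hwn⟩ := hex
  have hpos : 0 < (K + 1) / ‖I‖ := by positivity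
  have hb := γ.norm_contourIntegral_le hK (g := fun ζ => (ζ - w)⁻¹) (M := ((K + 1) / ‖I‖)⁻¹)
    fun ζ hζ => by
      have h1 : ‖ζ‖ ≤ R := by simpa using hRt hζ
      have h2 : ‖w‖ ≤ ‖ζ‖ + ‖ζ - w‖ := by simpa using norm_sub_le ζ (ζ - w)
      rw [norm_inv]
      gcongr
      linarith
  rw [hconst w hw, inv_div, mul_div_assoc', le_div_iff₀ (by positivity)] at hb
  nlinarith

end SimpleClosedCurve

/-! ### Cauchy's theorem for rectifiable curves -/

section
open MeasureTheory Metric Set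

/-- Subtracting the constant `G z` does not change the circle integral. This gains the factor `ε`
over the trivial bound without any holomorphy. -/
theorem norm_circleIntegral_le_of_forall_dist {G : ℂ → ℂ} (hG : Continuous G) {δ ε : ℝ}
    (hδ : 0 ≤ δ) {z : ℂ} (h : ∀ s ∈ sphere z δ, ‖G s - G z‖ ≤ ε) :
    ‖∮ s in C(z, δ), G s‖ ≤ 2 * Real.pi * δ * ε := by
  have h1 : (∮ s in C(z, δ), (G s - G z)) = ∮ s in C(z, δ), G s := by
    have h2 : (∮ _ in C(z, δ), G z) = 0 :=
      Complex.circleIntegral_eq_zero_of_differentiable_on_off_countable hδ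
        countable_empty continuousOn_const fun _ _ => differentiableAt_const _
    rw [circleIntegral.integral_sub hG.continuousOn.circleIntegrable'
      continuousOn_const.circleIntegrable', h2, sub_zero]
  rw [← h1]
  exact circleIntegral.norm_integral_le_of_norm_le_const hδ h

theorem continuous_integral_ball {G : ℂ → ℂ} (hG : Continuous G) (hGc : HasCompactSupport G)
    (δ : ℝ) : Continuous fun ζ => ∫ v in ball ζ δ, G v := by
  obtain ⟨M, hM⟩ := hG.bounded_above_of_compact_support hGc
  have h : (fun ζ => ∫ v in ball ζ δ, G v) = fun ζ => ∫ v in ball (0 : ℂ) δ, G (v + ζ) := by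
    funext ζ
    rw [← integral_indicator measurableSet_ball, ← integral_indicator measurableSet_ball,
      ← integral_add_right_eq_self _ ζ]
    refine integral_congr_ae (Filter.Eventually.of_forall fun v => ?_)
    dsimp only
    have hiff : v + ζ ∈ ball ζ δ ↔ v ∈ ball (0 : ℂ) δ := by simp
    by_cases hv : v ∈ ball (0 : ℂ) δ
    · rw [indicator_of_mem (hiff.2 hv), indicator_of_mem hv]
    · rw [indicator_of_notMem (mt hiff.1 hv), indicator_of_notMem hv]
  rw [h]
  refine continuous_of_dominated (bound := fun _ => M) (fun ζ => ?_) (fun ζ => ?_) ?_ ?_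
  · exact Continuous.aestronglyMeasurable (by fun_prop)
  · exact Filter.Eventually.of_forall fun v => hM _
  · exact integrableOn_const measure_ball_lt_top.ne
  · exact Filter.Eventually.of_forall fun v => by fun_prop

/-- A function continuous on a compact set extends to a continuous function of compact support. -/
theorem IsCompact.exists_continuous_hasCompactSupport_eqOn {K : Set ℂ} (hK : IsCompact K)
    {g : ℂ → ℂ} (hg : ContinuousOn g K) :
    ∃ G : ℂ → ℂ, Continuous G ∧ HasCompactSupport G ∧ EqOn G g K := by
  rcases K.eq_empty_or_nonempty with rfl | hne
  · exact ⟨0, continuous_const, HasCompactSupport.zero, by simp⟩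
  obtain ⟨F, hF⟩ := ContinuousMap.exists_restrict_eq hK.isClosed ⟨K.domRestrict g, hg.domRestrict⟩
  refine ⟨fun z => F z * ((max 0 (1 - infDist z K) : ℝ) : ℂ), ?_, ?_, ?_⟩
  · have := continuous_infDist_pt K
    have := F.continuous
    fun_prop
  · refine HasCompactSupport.intro (hK.cthickening (r := 1)) fun z hz => ?_
    have h1 : 1 ≤ infDist z K := by
      by_contra hlt
      exact hz (thickening_subset_cthickening 1 K
        ((mem_thickening_iff_infDist_lt hne).2 (not_le.1 hlt)))
    rw [max_eq_left (by linarith)]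
    simp
  · intro z hz
    have : F z = g z := DFunLike.congr_fun hF ⟨z, hz⟩
    simp [infDist_zero_of_mem hz, this]

end

namespace SimpleClosedCurve
open MeasureTheory Metric Set

variable (γ : SimpleClosedCurve)

theorem closedBall_subset_inside {z : ℂ} {δ : ℝ} (hδ : 0 ≤ δ) (hz : z ∈ γ.inside)
    (hzt : z ∉ cthickening δ γ.trace) : closedBall z δ ⊆ γ.inside := by
  refine γ.subset_inside_of_isPreconnected isPreconnected_closedBall (mem_closedBall_self hδ) hz ?_
  rw [disjoint_left]
  intro w hw hwt
  exact hzt (mem_cthickening_of_dist_le z w δ _ hwt (by rwa [dist_comm]))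

/-- The integral along the curve of disc averages of `G`, as an integral over the interior. -/
theorem integral_deriv_mul_integral_ball (hγ : γ.PositivelyOriented) {G : ℂ → ℂ}
    (hG : Continuous G) (hGc : HasCompactSupport G) {δ : ℝ} (hδ : 0 ≤ δ) :
    γ.contourIntegral (fun ζ => ∫ v in ball ζ δ, G v) =
      ∫ z in γ.inside, ∮ s in C(z, δ), G s := by
  obtain ⟨K, hK⟩ := γ.lipschitz
  obtain ⟨M, hM⟩ := hG.bounded_above_of_compact_support hGc
  obtain ⟨R, hR⟩ := hGc.isCompact.isBounded.subset_closedBall 0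
  have hGR : ∀ v, R < ‖v‖ → G v = 0 := fun v hv => by
    by_contra h
    have := hR (subset_tsupport G h)
    simp at this; linarith
  set h : ℂ → ℂ := fun z => ∮ s in C(z, δ), G s with hh
  have hhcont : Continuous h := by
    simp only [hh, circleIntegral]
    apply intervalIntegral.continuous_parametric_intervalIntegral_of_continuous'
    simp only [deriv_circleMap, circleMap]
    fun_prop
  have hhM : ∀ z, ‖h z‖ ≤ 2 * Real.pi * δ * M := fun z =>
    circleIntegral.norm_integral_le_of_norm_le_const hδ fun s _ => hM s
  have hhR : ∀ z, R + δ < ‖z‖ → h z = 0 := fun z hz => by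
    have h0 : EqOn G (fun _ => 0) (sphere z δ) := fun s hs => hGR s (by
      have h1 : ‖z‖ ≤ ‖s‖ + ‖z - s‖ := by simpa using norm_add_le s (z - s)
      have h2 : ‖z - s‖ = δ := by rw [norm_sub_rev]; simpa using hs
      linarith)
    refine (circleIntegral.integral_congr hδ h0).trans ?_
    simp [circleIntegral]
  -- Clamping the parameter gives a continuous curve on all of `ℝ`, and `a` cuts the derivative off,
  -- so that Fubini applies to globally measurable functions.
  set p : ℝ → ℂ := fun t => γ.toFun (projIcc (0 : ℝ) 1 zero_le_one t) with hp
  have hpcont : Continuous p :=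
    (continuousOn_iff_continuous_domRestrict.1 γ.continuousOn).comp continuous_projIcc
  have hpeq : ∀ t ∈ Ioo (0 : ℝ) 1, p t = γ.toFun t := fun t ht => by
    simp only [hp, projIcc_of_mem zero_le_one (Ioo_subset_Icc_self ht)]
  set a : ℝ → ℂ := (Ioo (0 : ℝ) 1).indicator (deriv γ.toFun) with ha
  have hameas : Measurable a := (measurable_deriv _).indicator measurableSet_Ioo
  have haK : ∀ t, ‖a t‖ ≤ K := fun t => by
    by_cases ht : t ∈ Ioo (0 : ℝ) 1
    · rw [ha, indicator_of_mem ht]; exact γ.norm_deriv_le hK ht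
    · rw [ha, indicator_of_notMem ht]; simp
  have hI : Integrable (fun q : ℝ × ℂ => (a q.1 * h q.2) * (p q.1 - q.2)⁻¹)
      ((volume.restrict (Ioo (0 : ℝ) 1)).prod volume) := by
    refine integrable_mul_inv_sub (g := fun q : ℝ × ℂ => a q.1 * h q.2) (p := p)
      (M := K * (2 * Real.pi * δ * M)) (R := R + δ) ?_ hpcont.measurable ?_ ?_
    · have := hhcont.measurable
      fun_prop
    · intro q
      rw [norm_mul]
      exact mul_le_mul (haK _) (hhM _) (norm_nonneg _) K.2
    · intro q hq
      rw [hhR _ hq, mul_zero]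
  have hpi : (2 * Real.pi * Complex.I : ℂ) ≠ 0 := Complex.two_pi_I_ne_zero
  have key : 2 * Real.pi * Complex.I * γ.contourIntegral (fun ζ => ∫ v in ball ζ δ, G v) =
      2 * Real.pi * Complex.I * ∫ z in γ.inside, h z := by
    calc 2 * Real.pi * Complex.I * γ.contourIntegral (fun ζ => ∫ v in ball ζ δ, G v)
        = ∫ t in Ioo (0 : ℝ) 1, ∫ z, (a t * h z) * (p t - z)⁻¹ := by
          rw [← contourIntegral_const_mul, contourIntegral]
          refine setIntegral_congr_fun measurableSet_Ioo fun t ht => ?_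
          rw [← integral_circleIntegral_mul_inv_sub hG hGc hδ, hpeq t ht, ha, indicator_of_mem ht,
            ← integral_const_mul]
          simp only [mul_assoc, hh]
      _ = ∫ z, ∫ t in Ioo (0 : ℝ) 1, (a t * h z) * (p t - z)⁻¹ :=
          integral_integral_swap hI
      _ = ∫ z, h z * γ.contourIntegral (fun ζ => (ζ - z)⁻¹) := by
          refine integral_congr_ae (Filter.Eventually.of_forall fun z => ?_)
          dsimp only
          rw [contourIntegral, ← integral_const_mul]
          refine setIntegral_congr_fun measurableSet_Ioo fun t ht => ?_
          rw [hpeq t ht, ha, indicator_of_mem ht]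
          ring
      -- The winding number is `1` inside and `0` outside; the curve itself is a null set.
      _ = ∫ z, γ.inside.indicator (fun z => 2 * Real.pi * Complex.I * h z) z := by
          refine integral_congr_ae ?_
          filter_upwards [measure_eq_zero_iff_ae_notMem.1 γ.volume_trace] with z hz
          by_cases hzi : z ∈ γ.inside
          · rw [indicator_of_mem hzi]
            have := hγ z hzi
            rw [windingNumber_eq, inv_mul_eq_iff_eq_mul₀ hpi, mul_one] at this
            rw [this, mul_comm]
          · have hzo : z ∈ γ.outside := by
              by_contra hzo
              have : z ∈ γ.inside ∪ γ.trace := by rw [← compl_outside]; exact hzo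
              exact this.elim hzi hz
            rw [indicator_of_notMem hzi, γ.contourIntegral_inv_sub_of_outside hzo, mul_zero]
      _ = _ := by
          rw [integral_indicator γ.isOpen_inside.measurableSet, integral_const_mul]
  exact mul_left_cancel₀ hpi key

/-- Cauchy's theorem for a rectifiable simple closed curve and a function that is holomorphic in
the interior and continuous up to the curve. -/
theorem contourIntegral_eq_zero (hγ : γ.PositivelyOriented) {g : ℂ → ℂ}
    (hgc : ContinuousOn g (γ.inside ∪ γ.trace)) (hgd : DifferentiableOn ℂ g γ.inside) :
    γ.contourIntegral g = 0 := by
  obtain ⟨K, hK⟩ := γ.lipschitz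
  obtain ⟨G, hG, hGc, hGg⟩ :=
    γ.isCompact_inside_union_trace.exists_continuous_hasCompactSupport_eqOn hgc
  obtain ⟨C, hC, hCvol⟩ := γ.exists_volume_cthickening_le
  have hGu := hGc.uniformContinuous_of_continuous hG
  rw [γ.contourIntegral_congr (h := G) fun z hz => (hGg (Or.inr hz)).symm]
  have hbound : ∀ ε > 0, ‖γ.contourIntegral G‖ ≤ (K + 2 * C) * ε := by
    intro ε hε
    obtain ⟨δ₀, hδ₀, hu⟩ := Metric.uniformContinuous_iff.1 hGu ε hε
    obtain ⟨δ, hδ, hδm⟩ : ∃ δ, 0 < δ ∧ δ < min δ₀ 1 := exists_between (by positivity)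
    have hδ1 : δ ≤ 1 := (hδm.trans_le (min_le_right _ _)).le
    have hδ2 : δ < δ₀ := hδm.trans_le (min_le_left _ _)
    have hclose : ∀ z, ∀ s ∈ closedBall z δ, ‖G s - G z‖ ≤ ε := fun z s hs => by
      rw [← dist_eq_norm]
      exact (hu ((mem_closedBall.1 hs).trans_lt hδ2)).le
    have hball : ∀ ζ : ℂ, (volume (ball ζ δ)).toReal = Real.pi * δ ^ 2 := fun ζ => by
      rw [Complex.volume_ball, ENNReal.toReal_mul, ENNReal.toReal_pow,
        ENNReal.toReal_ofReal hδ.le, mul_comm]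
      rfl
    have hGint : ∀ ζ : ℂ, IntegrableOn G (ball ζ δ) := fun ζ =>
      (hG.integrable_of_hasCompactSupport hGc).integrableOn
    have havg : ∀ ζ : ℂ, ‖(∫ v in ball ζ δ, G v) - (Real.pi * δ ^ 2 : ℝ) * G ζ‖ ≤
        Real.pi * δ ^ 2 * ε := fun ζ => by
      have h1 : (Real.pi * δ ^ 2 : ℝ) * G ζ = ∫ _ in ball ζ δ, G ζ := by
        rw [setIntegral_const, Measure.real, hball, Complex.real_smul]
      rw [h1, ← integral_sub (hGint ζ) (integrableOn_const measure_ball_lt_top.ne)]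
      have := norm_setIntegral_le_of_norm_le_const (μ := volume) (s := ball ζ δ) (C := ε)
        (f := fun v => G v - G ζ) measure_ball_lt_top
        fun v hv => hclose ζ v (ball_subset_closedBall hv)
      rwa [Measure.real, hball, mul_comm ε] at this
    -- Discs inside the curve contribute zero by Cauchy's theorem for circles. The other centres
    -- fill area at most `Cδ`, each with a circle integral at most `2πδε`; the product has the same
    -- order in `δ` as the disc area `πδ²`.
    have hin : ‖∫ z in γ.inside, ∮ s in C(z, δ), G s‖ ≤ 2 * Real.pi * δ * ε * (C * δ) := by
      have hzero : ∀ z ∈ γ.inside \ cthickening δ γ.trace, (∮ s in C(z, δ), G s) = 0 := by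
        rintro z ⟨hz, hzt⟩
        have hsub := γ.closedBall_subset_inside hδ.le hz hzt
        refine Complex.circleIntegral_eq_zero_of_differentiable_on_off_countable hδ.le
          countable_empty hG.continuousOn fun s hs => ?_
        have hs' : s ∈ γ.inside := hsub (ball_subset_closedBall hs.1)
        have hnhds := γ.isOpen_inside.mem_nhds hs'
        refine (hgd.differentiableAt hnhds).congr_of_eventuallyEq ?_
        filter_upwards [hnhds] with w hw using hGg (Or.inl hw)
      have hmeas : MeasurableSet (cthickening δ γ.trace) := isClosed_cthickening.measurableSet
      have hvol : volume (cthickening δ γ.trace ∩ γ.inside) ≤ ENNReal.ofReal (C * δ) :=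
        (measure_mono inter_subset_left).trans (hCvol δ hδ hδ1)
      have hsplit : ∫ z in γ.inside, ∮ s in C(z, δ), G s =
          ∫ z in cthickening δ γ.trace ∩ γ.inside, ∮ s in C(z, δ), G s := by
        refine (setIntegral_eq_of_subset_of_forall_sdiff_eq_zero γ.isOpen_inside.measurableSet
          inter_subset_right fun z hz => hzero z ⟨hz.1, fun h => hz.2 ⟨h, hz.1⟩⟩)
      rw [hsplit]
      have := norm_setIntegral_le_of_norm_le_const (μ := volume)
        (s := cthickening δ γ.trace ∩ γ.inside) (C := 2 * Real.pi * δ * ε)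
        (f := fun z => ∮ s in C(z, δ), G s) (hvol.trans_lt ENNReal.ofReal_lt_top)
        fun z _ => norm_circleIntegral_le_of_forall_dist hG hδ.le
          fun s hs => hclose z s (sphere_subset_closedBall hs)
      refine this.trans ?_
      gcongr
      exact ENNReal.toReal_le_of_le_ofReal (by positivity) hvol
    have havgcont : Continuous fun ζ => ∫ v in ball ζ δ, G v := continuous_integral_ball hG hGc δ
    have h1 := γ.norm_contourIntegral_le hK (M := Real.pi * δ ^ 2 * ε) fun ζ _ => havg ζ
    rw [γ.contourIntegral_sub havgcont.continuousOn (by fun_prop), contourIntegral_const_mul,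
      γ.integral_deriv_mul_integral_ball hγ hG hGc hδ.le] at h1
    have h2 : ‖((Real.pi * δ ^ 2 : ℝ) : ℂ) * γ.contourIntegral G‖ ≤
        K * (Real.pi * δ ^ 2 * ε) + 2 * Real.pi * δ * ε * (C * δ) := by
      have := norm_sub_le (∫ z in γ.inside, ∮ s in C(z, δ), G s)
        ((∫ z in γ.inside, ∮ s in C(z, δ), G s) -
          ((Real.pi * δ ^ 2 : ℝ) : ℂ) * γ.contourIntegral G)
      rw [sub_sub_cancel] at this
      linarith
    rw [norm_mul, Complex.norm_real, Real.norm_of_nonneg (by positivity)] at h2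
    have hpos : 0 < Real.pi * δ ^ 2 := by positivity
    refine le_of_mul_le_mul_left (h2.trans_eq ?_) hpos
    ring
  have hle : ‖γ.contourIntegral G‖ ≤ 0 := by
    refine le_of_forall_pos_le_add fun e he => ?_
    have hK0 : (0 : ℝ) ≤ K := K.2
    have := hbound (e / (K + 2 * C + 1)) (by positivity)
    rw [zero_add]
    refine this.trans ?_
    rw [mul_div_assoc', div_le_iff₀ (by positivity)]
    nlinarith
  exact norm_le_zero_iff.1 hle

/-- Cauchy's integral formula for points of the interior. -/
theorem contourIntegral_div_sub_of_inside (hγ : γ.PositivelyOriented) {f : ℂ → ℂ}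
    (hfc : ContinuousOn f (γ.inside ∪ γ.trace)) (hfd : DifferentiableOn ℂ f γ.inside)
    {μ : ℂ} (hμ : μ ∈ γ.inside) :
    γ.contourIntegral (fun z => f z * (z - μ)⁻¹) = 2 * Real.pi * Complex.I * f μ := by
  have hnhds : γ.inside ∈ nhds μ := γ.isOpen_inside.mem_nhds hμ
  have hne : ∀ z ∈ γ.trace, z - μ ≠ 0 := fun z hz h => by
    rw [sub_eq_zero] at h
    exact hμ.1 (h ▸ hz)
  have hinv : ContinuousOn (fun z => (z - μ)⁻¹) γ.trace := ContinuousOn.inv₀ (by fun_prop) hne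
  -- The difference quotient of `f` at `μ`, completed by `f'(μ)`, has no pole, so Cauchy's theorem
  -- applies to it.
  have h0 := γ.contourIntegral_eq_zero hγ (g := dslope f μ)
    ((continuousOn_dslope (Filter.mem_of_superset hnhds subset_union_left)).2
      ⟨hfc, hfd.differentiableAt hnhds⟩)
    ((Complex.differentiableOn_dslope hnhds).2 hfd)
  rw [γ.contourIntegral_congr (h := fun z => f z * (z - μ)⁻¹ - f μ * (z - μ)⁻¹) ?_,
    γ.contourIntegral_sub (g := fun z => f z * (z - μ)⁻¹) (h := fun z => f μ * (z - μ)⁻¹)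
      ((hfc.mono subset_union_right).mul hinv) (continuousOn_const.mul hinv),
    contourIntegral_const_mul, sub_eq_zero] at h0
  · have := hγ μ hμ
    rw [windingNumber_eq, inv_mul_eq_iff_eq_mul₀ Complex.two_pi_I_ne_zero, mul_one] at this
    rw [h0, this, mul_comm]
  · intro z hz
    dsimp only
    rw [dslope_of_ne _ (sub_ne_zero.1 (hne z hz)), slope_def_field, div_eq_mul_inv, sub_mul]

theorem contourIntegral_div_sub_of_outside (hγ : γ.PositivelyOriented) {f : ℂ → ℂ}
    (hfc : ContinuousOn f (γ.inside ∪ γ.trace)) (hfd : DifferentiableOn ℂ f γ.inside)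
    {μ : ℂ} (hμ : μ ∈ γ.outside) :
    γ.contourIntegral (fun z => f z * (z - μ)⁻¹) = 0 := by
  have hne : ∀ z ∈ γ.inside ∪ γ.trace, z - μ ≠ 0 := fun z hz h => by
    rw [sub_eq_zero] at h
    rw [← compl_outside] at hz
    exact hz (h ▸ hμ)
  refine γ.contourIntegral_eq_zero hγ (hfc.mul (ContinuousOn.inv₀ (by fun_prop) hne))
    (hfd.mul (DifferentiableOn.inv (by fun_prop) fun z hz => hne z (Or.inl hz)))

end SimpleClosedCurve

/-! ### Algebra of the block-Lanczos method -/

theorem Matrix.isUnit_of_card_le_rank {b : ℕ} {M : Matrix (Fin b) (Fin b) ℂ} (h : b ≤ M.rank) :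
    IsUnit M := by
  have htop : LinearMap.range M.mulVecLin = ⊤ := by
    apply Submodule.eq_top_of_finrank_eq
    refine le_antisymm (Submodule.finrank_le _) ?_
    rw [Module.finrank_fin_fun]
    exact h
  have hsurj : Function.Surjective M.mulVec := LinearMap.range_eq_top.1 htop
  exact Matrix.mulVec_surjective_iff_isUnit.1 hsurj

/-- The span of the columns of `Q_1, …, Q_j`. -/
def lanczosSpan {n b : ℕ} (Q : ℕ → Matrix (Fin n) (Fin b) ℂ) : ℕ → Submodule ℂ (Fin n → ℂ)
  | 0 => ⊥
  | j + 1 => lanczosSpan Q j ⊔ LinearMap.range (Q (j + 1)).mulVecLin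

/-- The product `B_j ⋯ B_0`. -/
def lanczosProd {b : ℕ} (B : ℕ → Matrix (Fin b) (Fin b) ℂ) : ℕ → Matrix (Fin b) (Fin b) ℂ
  | 0 => B 0
  | j + 1 => B (j + 1) * lanczosProd B j

theorem lanczosSpan_mono {n b : ℕ} (Q : ℕ → Matrix (Fin n) (Fin b) ℂ) :
    Monotone (lanczosSpan Q) := monotone_nat_of_le_succ fun _ => le_sup_left

theorem mulVec_mem_lanczosSpan {n b : ℕ} (Q : ℕ → Matrix (Fin n) (Fin b) ℂ) {i j : ℕ}
    (hi : 1 ≤ i) (hij : i ≤ j) (x : Fin b → ℂ) : Q i *ᵥ x ∈ lanczosSpan Q j := by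
  refine lanczosSpan_mono Q hij ?_
  obtain ⟨i, rfl⟩ := Nat.exists_eq_succ_of_ne_zero (by omega : i ≠ 0)
  exact le_sup_right (a := lanczosSpan Q i) ⟨x, rfl⟩

theorem finrank_lanczosSpan_le {n b : ℕ} (Q : ℕ → Matrix (Fin n) (Fin b) ℂ) (j : ℕ) :
    Module.finrank ℂ (lanczosSpan Q j) ≤ j * b := by
  induction j with
  | zero => rw [lanczosSpan, finrank_bot]; exact Nat.zero_le _
  | succ j ih =>
    refine (Submodule.finrank_add_le_finrank_add_finrank _ _).trans ?_
    have : Module.finrank ℂ (LinearMap.range (Q (j + 1)).mulVecLin) ≤ b := by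
      have := (Q (j + 1)).rank_le_width
      exact this
    rw [Nat.succ_mul]
    omega

theorem isUnit_of_isUnit_lanczosProd {b : ℕ} {B : ℕ → Matrix (Fin b) (Fin b) ℂ} {k : ℕ}
    (h : IsUnit (lanczosProd B k)) : ∀ j ≤ k, IsUnit (B j) := by
  induction k with
  | zero =>
    intro j hj
    obtain rfl : j = 0 := by omega
    exact h
  | succ k ih =>
    rw [Matrix.isUnit_iff_isUnit_det, lanczosProd, Matrix.det_mul, IsUnit.mul_iff,
      ← Matrix.isUnit_iff_isUnit_det, ← Matrix.isUnit_iff_isUnit_det] at h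
    intro j hj
    rcases Nat.lt_or_ge j (k + 1) with hlt | hge
    · exact ih h.2 j (by omega)
    · obtain rfl : j = k + 1 := by omega
      exact h.1

/-! ### Invertibility of the `B_j`, orthogonality of the blocks, the block-Lanczos relation -/

namespace IsBlockLanczos

variable {n b k : ℕ} {H : Matrix (Fin n) (Fin n) ℂ} {V : Matrix (Fin n) (Fin b) ℂ}
  {Q : ℕ → Matrix (Fin n) (Fin b) ℂ} {A B : ℕ → Matrix (Fin b) (Fin b) ℂ}

theorem conjTranspose_mul_self (hL : IsBlockLanczos H V k Q A B) {j : ℕ} (h1 : 1 ≤ j)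
    (h2 : j ≤ k + 1) : (Q j)ᴴ * Q j = 1 := by
  rcases Nat.lt_or_ge 1 j with h | h
  · have := (hL.next (j - 1) (by omega) (by omega)).1
    rwa [Nat.sub_add_cancel h1] at this
  · obtain rfl : j = 1 := by omega
    exact hL.start.1

theorem three_term (hL : IsBlockLanczos H V k Q A B) {j : ℕ} (h1 : 1 ≤ j) (h2 : j ≤ k) :
    H * Q j = Q (j + 1) * B j + Q j * A j +
      if j = 1 then 0 else Q (j - 1) * (B (j - 1))ᴴ := by
  have h := (hL.next j h1 h2).2.2
  rw [← h, lanczosZ]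
  split_ifs with hj
  · subst hj; simp
  · abel

theorem mulVec_lanczosSpan_le (hL : IsBlockLanczos H V k Q A B) {j : ℕ} (hj : j ≤ k) :
    ∀ v ∈ lanczosSpan Q j, H *ᵥ v ∈ lanczosSpan Q (j + 1) := by
  induction j with
  | zero =>
    intro v hv
    rw [lanczosSpan, Submodule.mem_bot] at hv
    simp [hv]
  | succ j ih =>
    intro v hv
    obtain ⟨v₁, hv₁, _, ⟨x, rfl⟩, rfl⟩ := Submodule.mem_sup.1 hv
    rw [Matrix.mulVec_add]
    refine add_mem (lanczosSpan_mono Q (by omega) (ih (by omega) v₁ hv₁)) ?_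
    rw [Matrix.mulVecLin_apply, Matrix.mulVec_mulVec, hL.three_term (by omega) hj,
      Matrix.add_mulVec, Matrix.add_mulVec]
    refine add_mem (add_mem ?_ ?_) ?_
    · rw [← Matrix.mulVec_mulVec]; exact mulVec_mem_lanczosSpan Q (by omega) le_rfl _
    · rw [← Matrix.mulVec_mulVec]; exact mulVec_mem_lanczosSpan Q (by omega) (by omega) _
    · split_ifs with h
      · simp
      · rw [← Matrix.mulVec_mulVec]; exact mulVec_mem_lanczosSpan Q (by omega) (by omega) _

/-- The leading term of `H^j V` is `Q_{j+1} B_j ⋯ B_0`: each product with `H` raises the block index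
by one, and the other two terms of the recurrence fall into earlier blocks. Orthogonality between
blocks, which is not yet available, plays no role. -/
theorem pow_mul_mulVec_sub_mem (hL : IsBlockLanczos H V k Q A B) {j : ℕ} (hj : j ≤ k)
    (x : Fin b → ℂ) :
    (H ^ j * V) *ᵥ x - (Q (j + 1) * lanczosProd B j) *ᵥ x ∈ lanczosSpan Q j := by
  induction j with
  | zero => rw [pow_zero, Matrix.one_mul, hL.start.2.2]; simp [lanczosProd]
  | succ j ih =>
    have h := hL.mulVec_lanczosSpan_le (by omega) _ (ih (by omega))
    rw [Matrix.mulVec_sub, Matrix.mulVec_mulVec, Matrix.mulVec_mulVec, ← Matrix.mul_assoc, ← Matrix.mul_assoc,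
      ← pow_succ', hL.three_term (j := j + 1) (by omega) hj] at h
    have h2 : (Q (j + 1) * A (j + 1) +
        if j + 1 = 1 then 0 else Q (j + 1 - 1) * (B (j + 1 - 1))ᴴ) *ᵥ (lanczosProd B j *ᵥ x) ∈
        lanczosSpan Q (j + 1) := by
      rw [Matrix.add_mulVec, ← Matrix.mulVec_mulVec]
      refine add_mem (mulVec_mem_lanczosSpan Q (by omega) (by omega) _) ?_
      split_ifs with h
      · simp
      · rw [← Matrix.mulVec_mulVec]; exact mulVec_mem_lanczosSpan Q (by omega) (by omega) _
    convert! add_mem h h2 using 1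
    simp only [lanczosProd, Matrix.mulVec_mulVec, Matrix.add_mul, Matrix.add_mulVec, Matrix.mul_assoc]
    abel

/-- Dimension count: the Krylov space lies in a space of dimension at most `kb` plus the range of
`Q_{k+1} B_k ⋯ B_0`, so the product `B_k ⋯ B_0` must have rank at least `b`. -/
theorem isUnit_B (hL : IsBlockLanczos H V k Q A B)
    (hV : Module.finrank ℂ (blockKrylov H V k) = (k + 1) * b) : ∀ j ≤ k, IsUnit (B j) := by
  apply isUnit_of_isUnit_lanczosProd
  apply Matrix.isUnit_of_card_le_rank
  have hle : blockKrylov H V k ≤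
      lanczosSpan Q k ⊔ LinearMap.range (Q (k + 1) * lanczosProd B k).mulVecLin := by
    refine Submodule.span_le.2 ?_
    rintro _ ⟨i, hi, q, rfl⟩
    have h := hL.pow_mul_mulVec_sub_mem hi (Pi.single q 1)
    rw [Matrix.mulVec_single_one] at h
    rcases Nat.lt_or_ge i k with hlt | hge
    · refine le_sup_left (a := lanczosSpan Q k) ?_
      have h3 := add_mem (lanczosSpan_mono Q (by omega : i ≤ k) h)
        (mulVec_mem_lanczosSpan Q (by omega : 1 ≤ i + 1) (by omega : i + 1 ≤ k)
          (lanczosProd B i *ᵥ Pi.single q 1))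
      rw [Matrix.mulVec_mulVec, sub_add_cancel] at h3
      exact h3
    · obtain rfl : i = k := by omega
      exact Submodule.mem_sup.2 ⟨_, h, _, ⟨Pi.single q 1, rfl⟩, by
        rw [Matrix.mulVecLin_apply, sub_add_cancel]⟩
  have h1 := (Submodule.finrank_mono hle).trans (Submodule.finrank_add_le_finrank_add_finrank _ _)
  have h2 := finrank_lanczosSpan_le Q k
  have h3 : Module.finrank ℂ (LinearMap.range (Q (k + 1) * lanczosProd B k).mulVecLin) ≤
      (lanczosProd B k).rank := Matrix.rank_mul_le_right _ _
  rw [hV, Nat.succ_mul] at h1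
  omega

/-- Induction on the largest index. For `i < j`, hermiticity moves `H` onto `Q_i`, and of `(H Q_i)*
Q_j` only the `Q_{i+1}` term can survive. Invertibility of `B_j` passes from `Q_{j+1} B_j` to
`Q_{j+1}`. -/
theorem conjTranspose_mul_of_lt (hH : H.IsHermitian) (hL : IsBlockLanczos H V k Q A B)
    (hB : ∀ j ≤ k, IsUnit (B j)) {j : ℕ} (hj : j ≤ k + 1) :
    ∀ i l, 1 ≤ i → i < l → l ≤ j → (Q i)ᴴ * Q l = 0 := by
  induction j with
  | zero => intro i l h1 h2 h3; omega
  | succ j ih =>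
    have ih := ih (by omega)
    intro i l h1 h2 h3
    rcases Nat.lt_or_ge l (j + 1) with hlt | hge
    · exact ih i l h1 h2 (by omega)
    obtain rfl : l = j + 1 := by omega
    have hjk : j ≤ k := by omega
    have hZ := (hL.next j (by omega) hjk).2.2
    have hself : ∀ {i}, 1 ≤ i → i ≤ j → (Q i)ᴴ * Q i = 1 := fun h1 h2 =>
      hL.conjTranspose_mul_self h1 (by omega)
    have hmul : ((Q i)ᴴ * Q (j + 1)) * B j = 0 := by
      rw [Matrix.mul_assoc, ← hZ, Matrix.mul_sub]
      rcases Nat.lt_or_ge i j with hij | hij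
      · have hHQ : (Q i)ᴴ * (H * Q j) = (H * Q i)ᴴ * Q j := by
          rw [Matrix.conjTranspose_mul, hH.eq, Matrix.mul_assoc]
        rw [lanczosZ, if_neg (by omega : j ≠ 1), Matrix.mul_sub, hHQ,
          hL.three_term h1 (by omega), ← Matrix.mul_assoc _ (Q j), ih i j h1 hij le_rfl, Matrix.zero_mul,
          sub_zero, Matrix.conjTranspose_add, Matrix.conjTranspose_add, Matrix.add_mul, Matrix.add_mul,
          Matrix.conjTranspose_mul, Matrix.conjTranspose_mul, Matrix.mul_assoc _ _ (Q j),
          Matrix.mul_assoc _ _ (Q j), ih i j h1 hij le_rfl, Matrix.mul_zero, add_zero]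
        have hlast : (if i = 1 then 0 else Q (i - 1) * (B (i - 1))ᴴ)ᴴ * Q j = 0 := by
          split_ifs with hi
          · simp
          · rw [Matrix.conjTranspose_mul, Matrix.mul_assoc, ih (i - 1) j (by omega) (by omega) le_rfl,
              Matrix.mul_zero]
        rw [hlast, add_zero, ← Matrix.mul_assoc (Q i)ᴴ]
        rcases Nat.lt_or_ge (i + 1) j with hij' | hij'
        · rw [ih (i + 1) j (by omega) hij' le_rfl, ih i (j - 1) h1 (by omega) (by omega)]
          simp
        -- Both remaining terms equal `B_i*`: the subtraction of `Q_{j-1} B_{j-1}*` in the algorithm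
        -- is exactly what cancels here.
        · obtain rfl : j = i + 1 := by omega
          rw [hself (by omega) le_rfl, Nat.add_sub_cancel, hself h1 (by omega)]
          simp
      · obtain rfl : i = j := by omega
        rw [← Matrix.mul_assoc, hself h1 le_rfl, Matrix.one_mul, ← hL.diag i h1 hjk, sub_self]
    obtain ⟨u, hu⟩ := hB j hjk
    rw [← hu] at hmul
    have := congrArg (· * (↑u⁻¹ : Matrix (Fin b) (Fin b) ℂ)) hmul
    simpa [Matrix.mul_assoc] using this

theorem conjTranspose_mul_of_ne (hH : H.IsHermitian) (hL : IsBlockLanczos H V k Q A B)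
    (hB : ∀ j ≤ k, IsUnit (B j)) {i l : ℕ} (hi : 1 ≤ i) (hl : 1 ≤ l) (hik : i ≤ k + 1)
    (hlk : l ≤ k + 1) (hil : i ≠ l) : (Q i)ᴴ * Q l = 0 := by
  rcases Nat.lt_or_gt_of_ne hil with h | h
  · exact hL.conjTranspose_mul_of_lt hH hB le_rfl i l hi h hlk
  · have := congrArg Matrix.conjTranspose
      (hL.conjTranspose_mul_of_lt hH hB le_rfl l i hl h hik)
    simpa using this

theorem isHermitian_A (hH : H.IsHermitian) (hL : IsBlockLanczos H V k Q A B)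
    (hB : ∀ j ≤ k, IsUnit (B j)) {j : ℕ} (h1 : 1 ≤ j) (h2 : j ≤ k) : (A j).IsHermitian := by
  have h : A j = (Q j)ᴴ * H * Q j := by
    rw [hL.diag j h1 h2, lanczosZ]
    split_ifs with hj
    · subst hj; rw [Matrix.mul_assoc]
    · rw [Matrix.mul_sub, ← Matrix.mul_assoc (Q j)ᴴ (Q (j - 1)),
        hL.conjTranspose_mul_of_ne hH hB h1 (by omega) (by omega) (by omega) (by omega : j ≠ j - 1),
        Matrix.zero_mul, sub_zero, Matrix.mul_assoc]
  rw [h]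
  exact Matrix.isHermitian_conjTranspose_mul_mul _ hH

theorem isHermitian_blockT (hH : H.IsHermitian) (hL : IsBlockLanczos H V k Q A B)
    (hB : ∀ j ≤ k, IsUnit (B j)) : (blockT k A B).IsHermitian := by
  ext ⟨p, c⟩ ⟨q, d⟩
  rw [Matrix.conjTranspose_apply]
  simp only [blockT, Matrix.of_apply]
  by_cases h : p = q
  · subst h
    simp only [if_true]
    exact (hL.isHermitian_A hH hB (by omega : 1 ≤ (p : ℕ) + 1) (by omega)).apply c d
  · rw [if_neg h, if_neg (Ne.symm h)]
    by_cases h2 : (p : ℕ) = q + 1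
    · rw [if_pos h2, if_neg (by omega), if_pos h2, Matrix.conjTranspose_apply, star_star]
    · rw [if_neg h2]
      by_cases h3 : (q : ℕ) = p + 1
      · simp only [if_pos h3, if_neg h2, Matrix.conjTranspose_apply]
      · rw [if_neg h3, if_neg h3, if_neg h2, star_zero]

theorem blockQ_conjTranspose_mul_last (hH : H.IsHermitian) (hL : IsBlockLanczos H V k Q A B)
    (hB : ∀ j ≤ k, IsUnit (B j)) : (blockQ k Q)ᴴ * Q (k + 1) = 0 := by
  ext ⟨p, c⟩ d
  have h : ((blockQ k Q)ᴴ * Q (k + 1)) (p, c) d = ((Q (p + 1))ᴴ * Q (k + 1)) c d := rfl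
  rw [h, hL.conjTranspose_mul_of_ne hH hB (by omega) (by omega) (by omega) (by omega) (by omega)]
  rfl

theorem _root_.blockQ_mul_blockE {Q : ℕ → Matrix (Fin n) (Fin b) ℂ} {i : ℕ} (h1 : 1 ≤ i)
    (h2 : i ≤ k) : blockQ k Q * blockE k b i = Q i := by
  ext r c
  rw [Matrix.mul_apply, Finset.sum_eq_single ((⟨i - 1, by omega⟩ : Fin k), c)]
  · simp [blockQ, blockE, Nat.sub_add_cancel h1]
  · rintro ⟨p, d⟩ - hne
    have : ¬ ((p : ℕ) + 1 = i ∧ d = c) := by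
      rintro ⟨h3, rfl⟩
      exact hne (Prod.ext (Fin.ext (by simp; omega)) rfl)
    simp [blockE, this]
  · simp

theorem _root_.mul_blockE_conjTranspose_apply (X : Matrix (Fin n) (Fin b) ℂ) (i : ℕ) (r : Fin n)
    (q : Fin k) (c : Fin b) :
    (X * (blockE k b i)ᴴ) r (q, c) = if (q : ℕ) + 1 = i then X r c else 0 := by
  rw [Matrix.mul_apply, Finset.sum_eq_single c]
  · simp only [Matrix.conjTranspose_apply, blockE, Matrix.of_apply, and_true]
    split_ifs <;> simp
  · rintro d - hne
    simp [blockE, hne.symm]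
  · simp

/-- Block column by block column this is the three-term recurrence; only in the last column does the
term `Q_{k+1} B_k` fall outside the range of the blocks in `Q`. -/
theorem mul_blockQ (hL : IsBlockLanczos H V k Q A B) :
    H * blockQ k Q = blockQ k Q * blockT k A B + Q (k + 1) * B k * (blockE k b k)ᴴ := by
  ext r ⟨q, c⟩
  have hleft : (H * blockQ k Q) r (q, c) = (H * Q (q + 1)) r c := rfl
  rw [hleft, hL.three_term (by omega) (by omega), Matrix.add_apply (blockQ k Q * _),
    mul_blockE_conjTranspose_apply]
  -- Summing over natural numbers `p < k` makes the boundary cases automatic: the subdiagonal term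
  -- drops out when `q + 1 = k`, the superdiagonal one when `q = 0`.
  have hsum : (blockQ k Q * blockT k A B) r (q, c) = ∑ p ∈ Finset.range k,
      ((if p = (q : ℕ) then (Q (q + 1) * A (q + 1)) r c else 0) +
        (if p = (q : ℕ) + 1 then (Q (q + 2) * B (q + 1)) r c else 0) +
        (if (q : ℕ) = p + 1 then (Q q * (B q)ᴴ) r c else 0)) := by
    rw [Matrix.mul_apply, Fintype.sum_prod_type, Finset.sum_range]
    refine Finset.sum_congr rfl fun p _ => ?_
    by_cases h : p = q
    · subst h
      simp [blockQ, blockT, Matrix.mul_apply]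
    · have h' : (p : ℕ) ≠ q := fun h2 => h (Fin.ext h2)
      by_cases h2 : (p : ℕ) = q + 1
      · have h3 : ¬ ((q : ℕ) = p + 1) := by omega
        simp [blockQ, blockT, Matrix.mul_apply, h, h2]
        omega
      · by_cases h3 : (q : ℕ) = p + 1
        · have h4 : ¬ ((p : ℕ) = p + 1 + 1) := by omega
          simp [blockQ, blockT, Matrix.mul_apply, h, h3, h4]
        · simp [blockQ, blockT, h, h', h2, h3]
  rw [hsum, Finset.sum_add_distrib, Finset.sum_add_distrib, Finset.sum_ite_eq', Finset.sum_ite_eq',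
    if_pos (Finset.mem_range.2 q.2)]
  have hlast : (∑ x ∈ Finset.range k, if (q : ℕ) = x + 1 then (Q q * (B q)ᴴ) r c else 0) =
      (if (q : ℕ) + 1 = 1 then 0 else Q (q + 1 - 1) * (B (q + 1 - 1))ᴴ) r c := by
    rcases Nat.eq_zero_or_pos (q : ℕ) with h0 | h0
    · rw [if_pos (by omega), h0, Finset.sum_eq_zero fun x _ => if_neg (by omega)]
      rfl
    · rw [if_neg (by omega), Finset.sum_eq_single_of_mem ((q : ℕ) - 1)
        (Finset.mem_range.2 (by omega)) fun x _ hx => if_neg (by omega), if_pos (by omega)]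
      rfl
  rw [hlast, Matrix.add_apply, Matrix.add_apply]
  by_cases hk : (q : ℕ) + 1 = k
  · have hX : (Q (k + 1) * B k) r c = (Q (q + 1 + 1) * B (q + 1)) r c := by rw [hk]
    rw [if_pos hk, if_neg (show ¬ ((q : ℕ) + 1 ∈ Finset.range k) by simp [hk]), hX]
    ring
  · rw [if_neg hk, if_pos (Finset.mem_range.2 (by omega))]
    ring

end IsBlockLanczos

/-! ### Resolvents and residuals -/

theorem Matrix.isUnit_sub_smul_one_of_notMem_spectrum {ι : Type*} [Fintype ι] [DecidableEq ι]
    {M : Matrix ι ι ℂ} {z : ℂ} (hz : z ∉ spectrum ℂ M) : IsUnit (M - z • 1) := by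
  have := spectrum.notMem_iff.1 hz
  rw [Algebra.algebraMap_eq_smul_one] at this
  rw [← neg_sub]
  exact this.neg

theorem Matrix.IsHermitian.star_notMem_spectrum {ι : Type*} [Fintype ι] [DecidableEq ι]
    {M : Matrix ι ι ℂ} (hM : M.IsHermitian) {z : ℂ} (hz : z ∉ spectrum ℂ M) :
    star z ∉ spectrum ℂ M := fun h => by
  have h2 := IsSelfAdjoint.mem_spectrum_eq_re hM h
  have h3 : star z = z := by
    have h4 : z = star ((star z).re : ℂ) := by rw [← h2, star_star]
    rw [h2, h4]; simp
  exact hz (h3 ▸ h)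

namespace IsBlockLanczos

variable {n b k : ℕ} {H : Matrix (Fin n) (Fin n) ℂ} {V : Matrix (Fin n) (Fin b) ℂ}
  {Q : ℕ → Matrix (Fin n) (Fin b) ℂ} {A B : ℕ → Matrix (Fin b) (Fin b) ℂ}

theorem eq_blockQ_mul (hk : 1 ≤ k) (hL : IsBlockLanczos H V k Q A B) :
    V = blockQ k Q * blockE k b 1 * B 0 := by
  rw [blockQ_mul_blockE le_rfl hk]
  exact hL.start.2.2

/-- In the shifted Lanczos relation the part in the range of `Q` reproduces `V = Q E₁ B₀` and
cancels, so the shift `u` enters only through `C(u)`. -/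
theorem lanRes_eq (hk : 1 ≤ k) (hL : IsBlockLanczos H V k Q A B) {u : ℂ}
    (hu : u ∉ spectrum ℂ (blockT k A B)) :
    lanRes H V k Q A B u = Q (k + 1) * B k * lanC k A B u := by
  have hunit := Matrix.isUnit_sub_smul_one_of_notMem_spectrum hu
  have hcancel : (blockT k A B - u • 1) * (blockT k A B - u • 1)⁻¹ = 1 :=
    Matrix.mul_nonsing_inv _ ((Matrix.isUnit_iff_isUnit_det _).1 hunit)
  have hshift : (H - u • 1) * blockQ k Q =
      blockQ k Q * (blockT k A B - u • 1) + Q (k + 1) * B k * (blockE k b k)ᴴ := by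
    rw [Matrix.sub_mul, hL.mul_blockQ, Matrix.mul_sub]
    simp only [Matrix.smul_mul, Matrix.mul_smul, Matrix.one_mul, Matrix.mul_one]
    abel
  rw [lanRes, hshift, Matrix.add_mul, Matrix.mul_assoc (blockQ k Q), hcancel, Matrix.mul_one,
    Matrix.add_mul, Matrix.add_mul, ← hL.eq_blockQ_mul hk, lanC, Matrix.mul_neg]
  simp only [Matrix.mul_assoc]
  abel

/-- `(H-z)⁻¹ res(z)` is the error of the approximate solution. Replacing `V*` by `res(z̄)*` on its
left subtracts only a multiple of `Q* res(z)`, which is zero. -/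
theorem resolvent_identity (hk : 1 ≤ k) (hH : H.IsHermitian) (hL : IsBlockLanczos H V k Q A B)
    (hB : ∀ j ≤ k, IsUnit (B j)) {z : ℂ} (hzH : z ∉ spectrum ℂ H)
    (hzT : z ∉ spectrum ℂ (blockT k A B)) :
    Vᴴ * (H - z • 1)⁻¹ * V -
        Vᴴ * (blockQ k Q * (blockT k A B - z • 1)⁻¹ * blockE k b 1 * B 0) =
      (lanRes H V k Q A B (star z))ᴴ * (H - z • 1)⁻¹ * lanRes H V k Q A B z := by
  have hT := hL.isHermitian_blockT hH hB
  have hunit := (Matrix.isUnit_iff_isUnit_det _).1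
    (Matrix.isUnit_sub_smul_one_of_notMem_spectrum hzH)
  set X := (H - z • 1)⁻¹ with hX
  have hXl : X * (H - z • 1) = 1 := Matrix.nonsing_inv_mul _ hunit
  have hXr : (H - z • 1) * X = 1 := Matrix.mul_nonsing_inv _ hunit
  set R := (blockT k A B - z • 1)⁻¹ * blockE k b 1 * B 0 with hR
  set R' := (blockT k A B - star z • 1)⁻¹ * blockE k b 1 * B 0 with hR'
  have hres : lanRes H V k Q A B z = V - (H - z • 1) * (blockQ k Q * R) := by
    rw [lanRes, hR]; simp only [Matrix.mul_assoc]
  have hres' : (lanRes H V k Q A B (star z))ᴴ =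
      Vᴴ - R'ᴴ * (blockQ k Q)ᴴ * (H - z • 1) := by
    have : lanRes H V k Q A B (star z) = V - (H - star z • 1) * (blockQ k Q * R') := by
      rw [lanRes, hR']; simp only [Matrix.mul_assoc]
    rw [this, Matrix.conjTranspose_sub, Matrix.conjTranspose_mul, Matrix.conjTranspose_mul,
      Matrix.conjTranspose_sub, Matrix.conjTranspose_smul, hH.eq, star_star,
      Matrix.conjTranspose_one]
  have horth : (blockQ k Q)ᴴ * lanRes H V k Q A B z = 0 := by
    rw [hL.lanRes_eq hk hzT, ← Matrix.mul_assoc, ← Matrix.mul_assoc,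
      hL.blockQ_conjTranspose_mul_last hH hB, Matrix.zero_mul, Matrix.zero_mul]
  have hXres : X * lanRes H V k Q A B z = X * V - blockQ k Q * R := by
    rw [hres, Matrix.mul_sub, ← Matrix.mul_assoc X, hXl, Matrix.one_mul]
  rw [hres', Matrix.sub_mul, Matrix.sub_mul, Matrix.mul_assoc _ (H - z • 1), hXr, Matrix.mul_one,
    Matrix.mul_assoc R'ᴴ, horth, Matrix.mul_zero, sub_zero, Matrix.mul_assoc Vᴴ X (lanRes H V k Q A B z), hXres,
    Matrix.mul_sub, hR]
  simp only [Matrix.mul_assoc]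

end IsBlockLanczos

/-! ### Entrywise conjugation -/

section Conj

variable {l m n : Type*}

theorem HasRealEntries.map_conj {M : Matrix m n ℂ} (h : HasRealEntries M) :
    M.map (starRingEnd ℂ) = M := by
  ext i j
  exact Complex.conj_eq_iff_im.2 (h i j)

theorem Matrix.map_conj_nonsing_inv [Fintype m] [DecidableEq m] (M : Matrix m m ℂ) :
    (M⁻¹).map (starRingEnd ℂ) = (M.map (starRingEnd ℂ))⁻¹ := by
  have h : ∀ N : Matrix m m ℂ, N.map (starRingEnd ℂ) = (Nᴴ)ᵀ := fun N => by ext i j; rfl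
  rw [h, h, Matrix.conjTranspose_nonsing_inv, Matrix.transpose_nonsing_inv]

theorem Matrix.l2_opNorm_map_conj_le [Fintype m] [Fintype n] [DecidableEq n] (M : Matrix m n ℂ) :
    ‖M.map (starRingEnd ℂ)‖ ≤ ‖M‖ := by
  rw [Matrix.l2_opNorm_def]
  refine ContinuousLinearMap.opNorm_le_bound _ (norm_nonneg _) fun x => ?_
  have h2 := Matrix.l2_opNorm_mulVec M (WithLp.toLp 2 (star x.ofLp))
  have h1 : M.map (starRingEnd ℂ) *ᵥ x.ofLp = star (M *ᵥ star x.ofLp) := by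
    ext i
    simp [Matrix.mulVec, dotProduct]
  calc _ = ‖WithLp.toLp 2 (M.map (starRingEnd ℂ) *ᵥ x.ofLp)‖ := rfl
    _ = ‖WithLp.toLp 2 (M *ᵥ star x.ofLp)‖ := by
        rw [h1]; simp [EuclideanSpace.norm_eq]
    _ ≤ ‖M‖ * ‖WithLp.toLp 2 (star x.ofLp)‖ := h2
    _ = _ := by congr 1; simp [EuclideanSpace.norm_eq]

theorem Matrix.l2_opNorm_map_conj [Fintype m] [Fintype n] [DecidableEq n] (M : Matrix m n ℂ) :
    ‖M.map (starRingEnd ℂ)‖ = ‖M‖ := by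
  refine le_antisymm (Matrix.l2_opNorm_map_conj_le M) ?_
  have h := Matrix.l2_opNorm_map_conj_le (M.map (starRingEnd ℂ))
  have h2 : (M.map (starRingEnd ℂ)).map (starRingEnd ℂ) = M := by ext i j; simp
  rwa [h2] at h

theorem Matrix.l2_opNorm_mul_of_conjTranspose_mul_self [Fintype l] [Fintype m] [Fintype n]
    [DecidableEq n] [DecidableEq m] {P : Matrix l m ℂ}
    (hP : Pᴴ * P = 1) (M : Matrix m n ℂ) : ‖P * M‖ = ‖M‖ := by
  have h := Matrix.l2_opNorm_conjTranspose_mul_self (P * M)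
  rw [Matrix.conjTranspose_mul, Matrix.mul_assoc, ← Matrix.mul_assoc Pᴴ, hP, Matrix.one_mul,
    Matrix.l2_opNorm_conjTranspose_mul_self] at h
  exact ((mul_self_inj (norm_nonneg _) (norm_nonneg _)).1 h).symm

end Conj

theorem lanC_map_conj {b k : ℕ} {A B : ℕ → Matrix (Fin b) (Fin b) ℂ}
    (hT : HasRealEntries (blockT k A B)) (hB : HasRealEntries (B 0)) (u : ℂ) :
    (lanC k A B u).map (starRingEnd ℂ) = lanC k A B (star u) := by
  have hE : ∀ i, (blockE k b i).map (starRingEnd ℂ) = blockE k b i := fun i => by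
    ext p q
    simp only [blockE, Matrix.map_apply, Matrix.of_apply]
    split_ifs <;> simp
  have hE' : ((blockE k b k)ᴴ).map (starRingEnd ℂ) = (blockE k b k)ᴴ := by
    conv_rhs => rw [← hE k]
    rfl
  have hTu : (blockT k A B - u • 1).map (starRingEnd ℂ) = blockT k A B - star u • 1 := by
    ext p q
    have := congrFun (congrFun hT.map_conj p) q
    simp only [Matrix.map_apply] at this
    by_cases hpq : p = q
    · subst hpq; simp [this]
    · simp [this, hpq]
  have hneg : ∀ M : Matrix (Fin b) (Fin b) ℂ,
      (-M).map (starRingEnd ℂ) = -(M.map (starRingEnd ℂ)) := fun M => by ext i j; simp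
  rw [lanC, hneg, Matrix.map_mul, Matrix.map_mul, Matrix.map_mul, hE, hE', hB.map_conj,
    Matrix.map_conj_nonsing_inv, hTu, lanC]

/-! ### Comparison of the residuals at `z`, at its conjugate and at `w` -/

namespace IsBlockLanczos

variable {n b k : ℕ} {H : Matrix (Fin n) (Fin n) ℂ} {V : Matrix (Fin n) (Fin b) ℂ}
  {Q : ℕ → Matrix (Fin n) (Fin b) ℂ} {A B : ℕ → Matrix (Fin b) (Fin b) ℂ}

theorem lanRes_eq_mul (hk : 1 ≤ k) (hL : IsBlockLanczos H V k Q A B) {w z : ℂ}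
    (hw : w ∉ spectrum ℂ (blockT k A B)) (hCw : IsUnit (lanC k A B w))
    (hz : z ∉ spectrum ℂ (blockT k A B)) :
    lanRes H V k Q A B z = lanRes H V k Q A B w * ((lanC k A B w)⁻¹ * lanC k A B z) := by
  rw [hL.lanRes_eq hk hz, hL.lanRes_eq hk hw, Matrix.mul_assoc _ (lanC k A B w),
    ← Matrix.mul_assoc (lanC k A B w), Matrix.mul_nonsing_inv _
      ((Matrix.isUnit_iff_isUnit_det _).1 hCw), Matrix.one_mul]

theorem norm_lanRes_le (hk : 1 ≤ k) (hL : IsBlockLanczos H V k Q A B) {w z : ℂ}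
    (hw : w ∉ spectrum ℂ (blockT k A B)) (hCw : IsUnit (lanC k A B w))
    (hz : z ∉ spectrum ℂ (blockT k A B)) :
    ‖lanRes H V k Q A B z‖ ≤
      ‖lanRes H V k Q A B w‖ * ‖(lanC k A B w)⁻¹ * lanC k A B z‖ := by
  rw [hL.lanRes_eq_mul hk hw hCw hz]
  exact Matrix.l2_opNorm_mul _ _

/-- Entrywise conjugation preserves the norm and sends `C(z)` to `C(z̄)`. For real `w` it is applied
to `C(w)⁻¹ C(z)`; for real `B_k`, to `B_k C(z)`, whose norm is that of `res(z)` because `Q_{k+1}`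
has orthonormal columns. -/
theorem norm_lanRes_star_le (hk : 1 ≤ k) (hH : H.IsHermitian) (hL : IsBlockLanczos H V k Q A B)
    (hB : ∀ j ≤ k, IsUnit (B j)) (hT : HasRealEntries (blockT k A B))
    (hB0 : HasRealEntries (B 0)) {w z : ℂ} (hwB : w.im = 0 ∨ HasRealEntries (B k))
    (hw : w ∉ spectrum ℂ (blockT k A B)) (hCw : IsUnit (lanC k A B w))
    (hz : z ∉ spectrum ℂ (blockT k A B)) :
    ‖lanRes H V k Q A B (star z)‖ ≤
      ‖lanRes H V k Q A B w‖ * ‖(lanC k A B w)⁻¹ * lanC k A B z‖ := by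
  have hz' := (hL.isHermitian_blockT hH hB).star_notMem_spectrum hz
  rcases hwB with hwr | hBk
  · refine (hL.norm_lanRes_le hk hw hCw hz').trans_eq ?_
    have hww : star w = w := Complex.conj_eq_iff_im.2 hwr
    rw [← Matrix.l2_opNorm_map_conj ((lanC k A B w)⁻¹ * lanC k A B z), Matrix.map_mul,
      Matrix.map_conj_nonsing_inv, lanC_map_conj hT hB0, lanC_map_conj hT hB0, hww]
  · have horth := hL.conjTranspose_mul_self (j := k + 1) (by omega) le_rfl
    have : ‖lanRes H V k Q A B (star z)‖ = ‖lanRes H V k Q A B z‖ := by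
      rw [hL.lanRes_eq hk hz, hL.lanRes_eq hk hz', Matrix.mul_assoc, Matrix.mul_assoc,
        Matrix.l2_opNorm_mul_of_conjTranspose_mul_self horth,
        Matrix.l2_opNorm_mul_of_conjTranspose_mul_self horth,
        ← Matrix.l2_opNorm_map_conj (B k * lanC k A B z), Matrix.map_mul, hBk.map_conj,
        lanC_map_conj hT hB0]
    rw [this]
    exact hL.norm_lanRes_le hk hw hCw hz

end IsBlockLanczos

/-! ### Functional calculus of Hermitian matrices -/

namespace Matrix.IsHermitian

variable {ι : Type*} [Fintype ι] [DecidableEq ι] {M : Matrix ι ι ℂ}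

/-- The coefficients of `g μ` are spectral projections. Allowing `σ` larger than the spectrum lets
`H` and `T` share one index set. -/
theorem cfc_eq_sum_of_spectrum_subset (hM : M.IsHermitian) {σ : Finset ℂ}
    (hσ : spectrum ℂ M ⊆ σ) (g : ℂ → ℂ) :
    cfc g M = ∑ μ ∈ σ, g μ • cfc (fun x => if x = μ then (1 : ℂ) else 0) M := by
  have hn : IsStarNormal M := IsSelfAdjoint.isStarNormal hM
  have hcont : ∀ h : ℂ → ℂ, ContinuousOn h (spectrum ℂ M) := fun h =>
    (Matrix.finite_spectrum M).continuousOn h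
  have h1 : cfc g M = cfc (∑ μ ∈ σ, fun x => g μ * (if x = μ then (1 : ℂ) else 0)) M := by
    refine cfc_congr fun x hx => ?_
    rw [Finset.sum_apply]
    simpa using fun h : x ∉ σ => absurd (Finset.mem_coe.1 (hσ hx)) h
  rw [h1, cfc_sum _ _ _ fun i _ => hcont _]
  refine Finset.sum_congr rfl fun μ _ => ?_
  exact cfc_const_mul _ _ _ (hcont _)

theorem inv_sub_smul_one_eq_cfc (hM : M.IsHermitian) {z : ℂ} (hz : z ∉ spectrum ℂ M) :
    (M - z • 1)⁻¹ = cfc (fun x => (x - z)⁻¹) M := by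
  have hn : IsStarNormal M := IsSelfAdjoint.isStarNormal hM
  have hcont : ∀ h : ℂ → ℂ, ContinuousOn h (spectrum ℂ M) := fun h =>
    (Matrix.finite_spectrum M).continuousOn h
  have h1 : cfc (fun x => x - z) M = M - z • 1 := by
    rw [cfc_sub (fun x => x) (fun _ => z) M (hcont _) (hcont _), cfc_id' ℂ M,
      cfc_const z M, Algebra.algebraMap_eq_smul_one]
  refine Matrix.inv_eq_right_inv ?_
  rw [← h1, ← cfc_mul _ _ M (hcont _) (hcont _), ← cfc_const_one ℂ M]
  refine cfc_congr fun x hx => mul_inv_cancel₀ fun h => ?_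
  rw [sub_eq_zero] at h
  exact hz (h ▸ hx)

theorem ofReal_norm_inv_sub_smul_one_le (hM : M.IsHermitian) {z : ℂ} (hz : z ∉ spectrum ℂ M)
    {S : Set ℝ} (hS : spectrum ℂ M ⊆ ((↑) : ℝ → ℂ) '' S) :
    ENNReal.ofReal ‖(M - z • 1)⁻¹‖ ≤ QTilde S z := by
  by_cases htop : QTilde S z = ∞
  · rw [htop]; exact le_top
  rw [← ENNReal.ofReal_toReal htop]
  refine ENNReal.ofReal_le_ofReal ?_
  rw [hM.inv_sub_smul_one_eq_cfc hz]
  refine norm_cfc_le ENNReal.toReal_nonneg fun x hx => ?_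
  obtain ⟨s, hs, rfl⟩ := hS hx
  have h1 : (ENNReal.ofReal ‖(s : ℂ) - z‖)⁻¹ ≤ QTilde S z :=
    le_iSup₂ (f := fun (x : ℝ) (_ : x ∈ S) => (ENNReal.ofReal ‖(x : ℂ) - z‖)⁻¹) s hs
  have hne : 0 < ‖(s : ℂ) - z‖ := norm_pos_iff.2 fun h => by
    rw [sub_eq_zero] at h
    exact hz (h ▸ hx)
  rw [← ENNReal.ofReal_inv_of_pos hne] at h1
  rw [norm_inv]
  exact (ENNReal.ofReal_le_iff_le_toReal htop).1 h1

end Matrix.IsHermitian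

/-! ### The error bound -/

section
open MeasureTheory Set

/-- The residue theorem for a function with simple poles enclosed once by a family of curves. -/
theorem sum_contourIntegral_mul_inv_sub {m : ℕ} (Γ : Fin m → SimpleClosedCurve)
    (hΓ : ∀ i, (Γ i).PositivelyOriented) {f : ℂ → ℂ}
    (hfc : ∀ i, ContinuousOn f ((Γ i).inside ∪ (Γ i).trace))
    (hfd : ∀ i, DifferentiableOn ℂ f (Γ i).inside) {μ : ℂ}
    (hμ : ∃ i, μ ∈ (Γ i).inside ∧ ∀ j, j ≠ i → μ ∈ (Γ j).outside) :
    ∑ i, (Γ i).contourIntegral (fun z => f z * (z - μ)⁻¹) = 2 * Real.pi * Complex.I * f μ := by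
  obtain ⟨i, hi, hj⟩ := hμ
  rw [Finset.sum_eq_single_of_mem i (Finset.mem_univ _) fun j _ hji =>
    (Γ j).contourIntegral_div_sub_of_outside (hΓ j) (hfc j) (hfd j) (hj j hji)]
  exact (Γ i).contourIntegral_div_sub_of_inside (hΓ i) (hfc i) (hfd i) hi

/-- Scalar Cauchy formulas suffice, since the vector-valued integrand is a finite combination of
simple poles. The bound is needed only off `σ`, which contains no point of the curves, and `g` may
be infinite. -/
theorem ofReal_norm_sum_smul_le {E : Type*} [NormedAddCommGroup E] [NormedSpace ℂ E]
    [CompleteSpace E] {m : ℕ} (Γ : Fin m → SimpleClosedCurve)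
    (hΓ : ∀ i, (Γ i).PositivelyOriented) {f : ℂ → ℂ}
    (hfc : ∀ i, ContinuousOn f ((Γ i).inside ∪ (Γ i).trace))
    (hfd : ∀ i, DifferentiableOn ℂ f (Γ i).inside) {σ : Finset ℂ}
    (hσ : ∀ μ ∈ σ, ∃ i, μ ∈ (Γ i).inside ∧ ∀ j, j ≠ i → μ ∈ (Γ j).outside)
    (W : ℂ → E) {g : ℂ → ℝ≥0∞}
    (hg : ∀ z, z ∉ σ → ENNReal.ofReal ‖f z‖ * ENNReal.ofReal ‖∑ μ ∈ σ, (μ - z)⁻¹ • W μ‖ ≤ g z) :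
    ENNReal.ofReal ‖∑ μ ∈ σ, f μ • W μ‖ ≤
      ENNReal.ofReal (1 / (2 * Real.pi)) * ∑ i, (Γ i).arcIntegral g := by
  have hnt : ∀ i, ∀ μ ∈ σ, μ ∉ (Γ i).trace := fun i μ hμ => by
    obtain ⟨j, hj, hj'⟩ := hσ μ hμ
    by_cases hij : i = j
    · subst hij; exact hj.1
    · exact (hj' i hij).1
  let F : Fin m → ℝ → E := fun i t =>
    (deriv (Γ i).toFun t * f ((Γ i).toFun t)) • ∑ μ ∈ σ, (μ - (Γ i).toFun t)⁻¹ • W μ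
  -- The minus sign comes from using `(μ - z)⁻¹`, which matches `(H - z)⁻¹`, in place of the Cauchy
  -- kernel `(z - μ)⁻¹`.
  have hF : ∀ i, ∫ t in Ioo (0 : ℝ) 1, F i t =
      -∑ μ ∈ σ, (Γ i).contourIntegral (fun z => f z * (z - μ)⁻¹) • W μ := fun i => by
    have h1 : ∀ t, F i t = ∑ μ ∈ σ, -((deriv (Γ i).toFun t *
        (f ((Γ i).toFun t) * ((Γ i).toFun t - μ)⁻¹)) • W μ) := fun t => by
      simp only [F, Finset.smul_sum, smul_smul]
      refine Finset.sum_congr rfl fun μ _ => ?_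
      rw [← neg_smul, ← neg_sub, inv_neg]
      congr 1
      ring
    simp only [h1]
    rw [integral_finsetSum, ← Finset.sum_neg_distrib]
    · refine Finset.sum_congr rfl fun μ _ => ?_
      rw [integral_neg, integral_smul_const]
      rfl
    · intro μ hμ
      refine (Integrable.smul_const ?_ _).neg
      refine (Γ i).integrable_deriv_mul (g := fun z => f z * (z - μ)⁻¹)
        (((hfc i).mono subset_union_right).mul (ContinuousOn.inv₀ (by fun_prop) fun z hz h => ?_))
      rw [sub_eq_zero] at h
      exact hnt i μ hμ (h ▸ hz)
  have hsum : ∑ i, ∫ t in Ioo (0 : ℝ) 1, F i t =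
      -(2 * Real.pi * Complex.I : ℂ) • ∑ μ ∈ σ, f μ • W μ := by
    simp only [hF]
    rw [Finset.sum_neg_distrib, Finset.sum_comm, neg_smul, Finset.smul_sum]
    congr 1
    refine Finset.sum_congr rfl fun μ hμ => ?_
    rw [← Finset.sum_smul, sum_contourIntegral_mul_inv_sub Γ hΓ hfc hfd (hσ μ hμ), smul_smul]
  have hnorm : ‖∑ μ ∈ σ, f μ • W μ‖ =
      1 / (2 * Real.pi) * ‖∑ i, ∫ t in Ioo (0 : ℝ) 1, F i t‖ := by
    rw [hsum, norm_smul, norm_neg]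
    simp only [norm_mul, Complex.norm_I, Complex.norm_real, Real.norm_of_nonneg Real.pi_pos.le]
    have := Real.pi_pos
    norm_num
    field_simp
  rw [hnorm, ENNReal.ofReal_mul (by positivity)]
  gcongr
  rw [ofReal_norm]
  refine (enorm_sum_le _ _).trans (Finset.sum_le_sum fun i _ => ?_)
  calc ‖∫ t in Ioo (0 : ℝ) 1, F i t‖ₑ ≤ ∫⁻ t in Ioo (0 : ℝ) 1, ‖F i t‖ₑ :=
        enorm_integral_le_lintegral_enorm _
    _ ≤ ∫⁻ t in Ioo (0 : ℝ) 1, g ((Γ i).toFun t) * ENNReal.ofReal ‖deriv (Γ i).toFun t‖ := by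
        refine setLIntegral_mono' measurableSet_Ioo fun t ht => ?_
        have h1 := hg ((Γ i).toFun t) fun hmem =>
          hnt i _ hmem ((Γ i).mem_trace_of_mem_Ioo ht)
        simp only [F]
        rw [enorm_smul, enorm_mul, ← ofReal_norm, ← ofReal_norm, ← ofReal_norm, mul_assoc,
          mul_comm]
        gcongr
    _ ≤ _ := lintegral_mono_set Ioo_subset_Icc_self

end

theorem mainTheorem2 {n b k : ℕ} (hk : 1 ≤ k)
    (H : Matrix (Fin n) (Fin n) ℂ) (hH : H.IsHermitian)
    (V : Matrix (Fin n) (Fin b) ℂ)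
    -- the block-Krylov space does not become degenerate
    (hV : Module.finrank ℂ (blockKrylov H V k) = (k + 1) * b)
    (Q : ℕ → Matrix (Fin n) (Fin b) ℂ) (A B : ℕ → Matrix (Fin b) (Fin b) ℂ)
    (hL : IsBlockLanczos H V k Q A B)
    -- `T` and `B_0` are real, and so is `B_k` unless `w` is
    (hT : HasRealEntries (blockT k A B)) (hB : HasRealEntries (B 0))
    (w : ℂ) (hwB : w.im = 0 ∨ HasRealEntries (B k))
    -- `C(w)` is defined and invertible
    (hw : w ∉ spectrum ℂ (blockT k A B)) (hCw : IsUnit (lanC k A B w))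
    (S : Set ℝ) (hS : spectrum ℂ H ⊆ ((↑) : ℝ → ℂ) '' S)
    -- the contour: finitely many simple closed curves
    {m : ℕ} (Γ : Fin m → SimpleClosedCurve)
    (hΓ : ∀ i, (Γ i).PositivelyOriented)
    -- every eigenvalue of `H` and of `T` is enclosed once
    (hencl : ∀ μ ∈ spectrum ℂ H ∪ spectrum ℂ (blockT k A B),
      ∃ i, μ ∈ (Γ i).inside ∧ ∀ j, j ≠ i → μ ∈ (Γ j).outside)
    (f : ℂ → ℂ)
    (hfcont : ∀ i, ContinuousOn f ((Γ i).inside ∪ (Γ i).trace))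
    (hfan : ∀ i, AnalyticOnNhd ℂ f (Γ i).inside) :
    ENNReal.ofReal ‖Vᴴ * cfc f H * V - Vᴴ * lanFA k Q A B f‖ ≤
      (ENNReal.ofReal (1 / (2 * Real.pi)) * ∑ i, (Γ i).arcIntegral fun z =>
        ENNReal.ofReal ‖f z‖ * QTilde S z *
          ENNReal.ofReal ‖(lanC k A B w)⁻¹ * lanC k A B z‖ ^ 2) *
      ENNReal.ofReal ‖lanRes H V k Q A B w‖ ^ 2 := by
  have hBu := hL.isUnit_B hV
  have hTh := hL.isHermitian_blockT hH hBu
  set ρ := ENNReal.ofReal ‖lanRes H V k Q A B w‖ with hρ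
  set D : ℂ → ℝ≥0∞ := fun z => ENNReal.ofReal ‖(lanC k A B w)⁻¹ * lanC k A B z‖ with hD
  let σ : Finset ℂ := ((Matrix.finite_spectrum H).union
    (Matrix.finite_spectrum (blockT k A B))).toFinset
  have hσ : ∀ μ, μ ∈ σ ↔ μ ∈ spectrum ℂ H ∪ spectrum ℂ (blockT k A B) := fun μ =>
    Set.Finite.mem_toFinset _
  have hσH : spectrum ℂ H ⊆ σ := fun μ h => (hσ μ).2 (Or.inl h)
  have hσT : spectrum ℂ (blockT k A B) ⊆ σ := fun μ h => (hσ μ).2 (Or.inr h)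
  -- `W μ` is the error committed on the indicator function of `μ`; the expansion `hW` is used for
  -- `f` itself and for `x ↦ (x - z)⁻¹`.
  let W : ℂ → Matrix (Fin b) (Fin b) ℂ := fun μ =>
    Vᴴ * cfc (fun x => if x = μ then (1 : ℂ) else 0) H * V -
      Vᴴ * lanFA k Q A B (fun x => if x = μ then (1 : ℂ) else 0)
  have hW : ∀ g : ℂ → ℂ, Vᴴ * cfc g H * V - Vᴴ * lanFA k Q A B g = ∑ μ ∈ σ, g μ • W μ := by
    intro g
    simp only [W, lanFA, smul_sub, Finset.sum_sub_distrib]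
    rw [hH.cfc_eq_sum_of_spectrum_subset hσH g, hTh.cfc_eq_sum_of_spectrum_subset hσT g]
    simp only [Matrix.mul_sum, Matrix.sum_mul, Matrix.mul_smul, Matrix.smul_mul]
  have hcomplete : CompleteSpace (Matrix (Fin b) (Fin b) ℂ) := FiniteDimensional.complete ℂ _
  have hmain := ofReal_norm_sum_smul_le Γ hΓ hfcont (fun i => (hfan i).differentiableOn)
    (fun μ hμ => hencl μ ((hσ μ).1 hμ)) W
    (g := fun z => ENNReal.ofReal ‖f z‖ * QTilde S z * D z ^ 2 * ρ ^ 2) fun z hz => by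
      have hzH : z ∉ spectrum ℂ H := fun h => hz (hσH h)
      have hzT : z ∉ spectrum ℂ (blockT k A B) := fun h => hz (hσT h)
      have h1 := hL.resolvent_identity hk hH hBu hzH hzT
      have h2 := hW fun x => (x - z)⁻¹
      rw [lanFA, ← hH.inv_sub_smul_one_eq_cfc hzH, ← hTh.inv_sub_smul_one_eq_cfc hzT, h1] at h2
      rw [← h2]
      have h3 : ENNReal.ofReal ‖(lanRes H V k Q A B (star z))ᴴ * (H - z • 1)⁻¹ *
          lanRes H V k Q A B z‖ ≤ (ρ * D z) * QTilde S z * (ρ * D z) := by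
        calc _ ≤ ENNReal.ofReal (‖lanRes H V k Q A B (star z)‖ * ‖(H - z • 1)⁻¹‖ *
              ‖lanRes H V k Q A B z‖) := by
              refine ENNReal.ofReal_le_ofReal ?_
              refine (Matrix.l2_opNorm_mul _ _).trans ?_
              gcongr
              refine (Matrix.l2_opNorm_mul _ _).trans ?_
              rw [Matrix.l2_opNorm_conjTranspose]
          _ = ENNReal.ofReal ‖lanRes H V k Q A B (star z)‖ * ENNReal.ofReal ‖(H - z • 1)⁻¹‖ *
              ENNReal.ofReal ‖lanRes H V k Q A B z‖ := by
              rw [ENNReal.ofReal_mul (by positivity), ENNReal.ofReal_mul (by positivity)]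
          _ ≤ _ := by
              gcongr
              · rw [hρ, hD, ← ENNReal.ofReal_mul (norm_nonneg _)]
                exact ENNReal.ofReal_le_ofReal
                  (hL.norm_lanRes_star_le hk hH hBu hT hB hwB hw hCw hzT)
              · exact hH.ofReal_norm_inv_sub_smul_one_le hzH hS
              · rw [hρ, hD, ← ENNReal.ofReal_mul (norm_nonneg _)]
                exact ENNReal.ofReal_le_ofReal (hL.norm_lanRes_le hk hw hCw hzT)
      refine (mul_le_mul_right h3 _).trans_eq ?_
      ring
  rw [← hW] at hmain
  refine hmain.trans_eq ?_
  have harc : ∀ i, (Γ i).arcIntegral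
      (fun z => ENNReal.ofReal ‖f z‖ * QTilde S z * D z ^ 2 * ρ ^ 2) =
      (Γ i).arcIntegral (fun z => ENNReal.ofReal ‖f z‖ * QTilde S z * D z ^ 2) * ρ ^ 2 := by
    intro i
    -- Finiteness of `ρ ^ 2` lets the constant leave the integral without measurability of the
    -- integrand.
    rw [SimpleClosedCurve.arcIntegral, SimpleClosedCurve.arcIntegral,
      ← MeasureTheory.lintegral_mul_const' _ _ (by simp [hρ])]
    refine MeasureTheory.lintegral_congr fun t => ?_
    ring
  simp only [harc]
  rw [← Finset.sum_mul, mul_assoc]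

end
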